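/- Let $k$ be a commutative ring; all algebras are commutative $k$-algebras, simplicial algebras consist of unital ones. Let $\mathbf E$ be a free simplicial algebra: for each $m\ge 1$ there is a family of generators in $E_m$, all of whose faces vanish except possibly $d_m$, such that each $E_n$ is the polynomial $E_0$-algebra on all (iterated) degeneracies in dimension $n$ of the generators of dimension $1\le m\le n$. Let $\mathbf E^{(j)}$ be its $j$-skeleton, the simplicial subalgebra generated by the simplices of dimension $\le j$. For a simplicial algebra $\mathbf X$ put $NX_n=\bigcap_{i<n}\ker d_i^n$, $\partial_n=d_n^n|_{NX_n}$, let $D_n\subseteq X_n$ be the subalgebra generated by the degenerate elements, and let $\mathbf C^{(2)}(\mathbf X)_2=NX_2/\partial_3(NX_3\cap D_3)$ be the degree-2 term of its 2-crossed complex, with $X_1$ acting through $s_1$ and with boundary to $X_1$ induced by $d_2$. A crossed $A$-module is a (non-unital) commutative $A$-algebra $C$ with an $A$-linear multiplicative map $\partial:C\to A$ such that $\partial(c)\cdot c'=cc'$. For ideals $J,I$ of $A$, $J\otimes I=J\otimes_A I$ has product $(n\otimes m)(n'\otimes m')=nn'\otimes mm'$ and boundary $n\otimes m\mapsto nm$.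 The coproduct $M\sqcup N$ of crossed $A$-modules, with injections $i,j$, is the quotient of the semidirect product $M\rtimes N$ by the ideal generated by the elements $pq-\partial(p)q$, where $\partial(m,n)=\partial m+\partial n$. (1) With $A=E^{(1)}_1$, there is an isomorphism of $A$-algebras, compatible with the boundaries to $A$, $$\ker d_1^1\otimes\ker d_0^1\;\cong\;\mathbf C^{(2)}(\mathbf E^{(1)})_2,\qquad y\otimes x\mapsto [\,s_1x\,(s_1y-s_0y)\,].$$ (2) With $A=E^{(2)}_1$, let $\partial:C\to A$ be the free crossed $A$-module on the function $t\mapsto d_2t$ from the set of generators of dimension $2$ to $A$. Then $\partial C\subseteq\ker d_0^1\cap\ker d_1^1$, and there is an isomorphism of $A$-algebras, compatible with the boundaries to $A$, $$\bigl((\ker d_1^1\otimes\ker d_0^1)\sqcup C\bigr)/\!\sim\;\;\cong\;\mathbf C^{(2)}(\mathbf E^{(2)})_2,$$ where $\sim$ is generated by $i(n\otimes\partial c)\sim j(n\cdot c)$ and $i(\partial c\otimes m)\sim j(m\cdot c)$ for $c\in C$, $n\in\ker d_1^1$, $m\in\ker d_0^1$. It sends the class of $i(y\otimes x)$ to $[\,s_1x(s_1y-s_0y)\,]$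 and the class of $j(t)$ to $[t]$ for each generator $t$ of dimension 2. -/

import Mathlib

open CategoryTheory Opposite Simplicial
open scoped TensorProduct

universe u v

namespace SimpAlg

/-! ### Crossed modules of commutative algebras -/

section CrossedModules

set_option linter.unusedSectionVars false

variable {A : Type v} [CommRing A]

/-- A crossed `A`-module: a (not necessarily unital) commutative `A`-algebra `C`, the `A`-module
structure being the action of `A` on `C`, with an `A`-equivariant multiplicative map `∂ : C → A`
such that `∂ c • c' = c * c'`. -/
def IsCrossedModule {C : Type v} [NonUnitalCommRing C] [Module A C] (bd : C →ₙₐ[A] A) : Prop :=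
  ∀ c c' : C, bd c • c' = c * c'

/-- `(C, ∂)` together with `ι : T → C` is the free crossed `A`-module on the function
`f : T → A`. -/
def IsFreeCrossedModule {T : Type v} (f : T → A) {C : Type v} [NonUnitalCommRing C] [Module A C]
    (bd : C →ₙₐ[A] A) (ι : T → C) : Prop :=
  IsCrossedModule bd ∧ (∀ t, bd (ι t) = f t) ∧
    ∀ (C' : Type v) [NonUnitalCommRing C'] [Module A C'] [IsScalarTower A C' C']
      [SMulCommClass A C' C'] (bd' : C' →ₙₐ[A] A) (g : T → C'),
      IsCrossedModule bd' → (∀ t, bd' (g t) = f t) →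
        ∃! φ : C →ₙₐ[A] C', (∀ c, bd' (φ c) = bd c) ∧ ∀ t, φ (ι t) = g t

/-- The crossed `A`-module given by an ideal of `A` and its inclusion. -/
def idealIncl (I : Ideal A) : I →ₙₐ[A] A where
  toFun x := x
  map_smul' _ _ := rfl
  map_zero' := rfl
  map_add' _ _ := rfl
  map_mul' _ _ := rfl

/-! ### Quotients of non-unital commutative algebras -/

/-- An ideal of a non-unital commutative `A`-algebra, stable under the action of `A`. -/
structure ActIdeal (A : Type v) [CommRing A] (P : Type v) [NonUnitalCommRing P] [Module A P]
    extends Submodule A P where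
  mul_mem' : ∀ (p : P) (x : P), x ∈ toSubmodule → p * x ∈ toSubmodule

section Quotient

variable {P : Type v} [NonUnitalCommRing P] [Module A P]

/-- The smallest `A`-stable ideal containing a set. -/
def actSpan (A : Type v) [CommRing A] {P : Type v} [NonUnitalCommRing P] [Module A P]
    (s : Set P) : ActIdeal A P where
  toSubmodule := sInf {N | s ⊆ (N : Set P) ∧ ∀ (p x : P), x ∈ N → p * x ∈ N}
  mul_mem' p x hx := by
    simp only [Submodule.mem_sInf, Set.mem_ofPred_eq] at hx ⊢
    exact fun N hN => hN.2 p x (hx N hN)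

/-- The quotient `P / N` of an algebra by an `A`-stable ideal. -/
def ActIdeal.Quot (N : ActIdeal A P) : Type v := P ⧸ N.toSubmodule

namespace ActIdeal

variable (N : ActIdeal A P)

instance : AddCommGroup N.Quot := inferInstanceAs (AddCommGroup (P ⧸ N.toSubmodule))
instance : Module A N.Quot := inferInstanceAs (Module A (P ⧸ N.toSubmodule))

/-- The projection `P → P / N`. -/
def proj (p : P) : N.Quot := Submodule.Quotient.mk p

theorem proj_eq {p q : P} : N.proj p = N.proj q ↔ p - q ∈ N.toSubmodule :=
  Submodule.Quotient.eq _

theorem proj_surj (x : N.Quot) : ∃ p, N.proj p = x := Submodule.Quotient.mk_surjective _ x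

instance : Mul N.Quot where
  mul := Quotient.map₂ (· * ·) (by
    intro a a' ha b b' hb
    have ha : a - a' ∈ N.toSubmodule := (Submodule.quotientRel_def _).1 ha
    have hb : b - b' ∈ N.toSubmodule := (Submodule.quotientRel_def _).1 hb
    refine (Submodule.quotientRel_def _).2 ?_
    have h : a * b - a' * b' = b * (a - a') + a' * (b - b') := by
      rw [mul_sub, mul_sub, mul_comm b a, mul_comm b a']; abel
    rw [h]
    exact N.toSubmodule.add_mem (N.mul_mem' _ _ ha) (N.mul_mem' _ _ hb))

theorem proj_mul (p q : P) : N.proj (p * q) = N.proj p * N.proj q := rfl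
theorem proj_add (p q : P) : N.proj (p + q) = N.proj p + N.proj q := rfl
theorem proj_smul (a : A) (p : P) : N.proj (a • p) = a • N.proj p := rfl
theorem proj_zero : N.proj 0 = 0 := rfl

instance : NonUnitalCommRing N.Quot where
  left_distrib x y z := by
    obtain ⟨x, rfl⟩ := N.proj_surj x
    obtain ⟨y, rfl⟩ := N.proj_surj y
    obtain ⟨z, rfl⟩ := N.proj_surj z
    simp only [← proj_mul, ← proj_add, mul_add]
  right_distrib x y z := by
    obtain ⟨x, rfl⟩ := N.proj_surj x
    obtain ⟨y, rfl⟩ := N.proj_surj y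
    obtain ⟨z, rfl⟩ := N.proj_surj z
    simp only [← proj_mul, ← proj_add, add_mul]
  zero_mul x := by
    obtain ⟨x, rfl⟩ := N.proj_surj x
    rw [← proj_zero, ← proj_mul, zero_mul]
  mul_zero x := by
    obtain ⟨x, rfl⟩ := N.proj_surj x
    rw [← proj_zero, ← proj_mul, mul_zero]
  mul_assoc x y z := by
    obtain ⟨x, rfl⟩ := N.proj_surj x
    obtain ⟨y, rfl⟩ := N.proj_surj y
    obtain ⟨z, rfl⟩ := N.proj_surj z
    simp only [← proj_mul, mul_assoc]
  mul_comm x y := by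
    obtain ⟨x, rfl⟩ := N.proj_surj x
    obtain ⟨y, rfl⟩ := N.proj_surj y
    simp only [← proj_mul, mul_comm]

/-- The map induced on the quotient by a map vanishing on the ideal. -/
def lift {Q : Type v} [NonUnitalCommRing Q] [Module A Q] (φ : P →ₙₐ[A] Q)
    (h : ∀ x ∈ N.toSubmodule, φ x = 0) : N.Quot →ₙₐ[A] Q where
  toFun := N.toSubmodule.liftQ (φ : P →ₗ[A] Q) (fun x hx => h x hx)
  map_smul' a x := map_smul _ a x
  map_zero' := map_zero _
  map_add' x y := map_add _ x y
  map_mul' x y := by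
    obtain ⟨x, rfl⟩ := N.proj_surj x
    obtain ⟨y, rfl⟩ := N.proj_surj y
    exact map_mul φ x y

end ActIdeal

/-- A map killing `s` and (equivariant, multiplicative) kills the ideal generated by `s`. -/
theorem actSpan_le_ker {Q : Type v} [NonUnitalCommRing Q] [Module A Q] (φ : P →ₙₐ[A] Q)
    {s : Set P} (h : ∀ x ∈ s, φ x = 0) : ∀ x ∈ (actSpan A s).toSubmodule, φ x = 0 := by
  intro x hx
  refine (Submodule.mem_sInf.1 hx) (LinearMap.ker (φ : P →ₗ[A] Q)) ⟨fun y hy => h y hy, ?_⟩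
  intro p y hy
  have hy : φ y = 0 := hy
  change φ (p * y) = 0
  rw [map_mul, hy, mul_zero]

end Quotient

/-! ### Tensor product of crossed modules -/

section Tensor

variable {M N : Type v} [NonUnitalCommRing M] [Module A M] [IsScalarTower A M M]
  [SMulCommClass A M M] [NonUnitalCommRing N] [Module A N] [IsScalarTower A N N]
  [SMulCommClass A N N]

instance : NonUnitalCommRing (M ⊗[A] N) where
  mul_comm x y := by
    induction x with
    | zero => rw [zero_mul, mul_zero]
    | add a b ha hb => rw [add_mul, mul_add, ha, hb]
    | tmul m n =>
      induction y with
      | zero => rw [zero_mul, mul_zero]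
      | add a b ha hb => rw [add_mul, mul_add, ha, hb]
      | tmul m' n' =>
        rw [Algebra.TensorProduct.tmul_mul_tmul, Algebra.TensorProduct.tmul_mul_tmul,
          mul_comm m, mul_comm n]

/-- The boundary `M ⊗ N → A`, `m ⊗ n ↦ ∂ m * ∂ n`, of the tensor product of two crossed
`A`-modules. The product of `M ⊗ N` is `(m ⊗ n) * (m' ⊗ n') = (m * m') ⊗ (n * n')`. -/
def tensorBd (bd₁ : M →ₙₐ[A] A) (bd₂ : N →ₙₐ[A] A) : M ⊗[A] N →ₙₐ[A] A where
  toFun := TensorProduct.lift ((LinearMap.mul A A).compl₁₂ (bd₁ : M →ₗ[A] A) (bd₂ : N →ₗ[A] A))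
  map_smul' a x := map_smul _ a x
  map_zero' := map_zero _
  map_add' x y := map_add _ x y
  map_mul' x y := by
    induction x with
    | zero => rw [zero_mul, map_zero, zero_mul]
    | add a b ha hb => rw [add_mul, map_add, map_add, ha, hb, add_mul]
    | tmul m n =>
      induction y with
      | zero => rw [mul_zero, map_zero, mul_zero]
      | add a b ha hb => rw [mul_add, map_add, map_add, ha, hb, mul_add]
      | tmul m' n' =>
        have h : bd₁ (m * m') * bd₂ (n * n') = bd₁ m * bd₂ n * (bd₁ m' * bd₂ n') := by
          rw [map_mul, map_mul, mul_mul_mul_comm]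
        simpa using h

end Tensor

/-! ### Coproduct of crossed modules -/

section Coproduct

variable {M N : Type v} [NonUnitalCommRing M] [Module A M] [IsScalarTower A M M]
  [SMulCommClass A M M] [NonUnitalCommRing N] [Module A N] [IsScalarTower A N N]
  [SMulCommClass A N N]

/-- The semidirect product `M ⋊ N`, where `M` acts on `N` through `∂ : M → A`. -/
@[ext] structure Semi (bd₁ : M →ₙₐ[A] A) (N : Type v) where
  fst : M
  snd : N

namespace Semi

variable {bd₁ : M →ₙₐ[A] A}

/-- The underlying set of `M ⋊ N` is `M × N`. -/
def equivProd (bd₁ : M →ₙₐ[A] A) (N : Type v) : Semi bd₁ N ≃ M × N where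
  toFun p := (p.fst, p.snd)
  invFun p := ⟨p.1, p.2⟩

instance : AddCommGroup (Semi bd₁ N) := (equivProd bd₁ N).addCommGroup
instance : Module A (Semi bd₁ N) := (equivProd bd₁ N).module A

instance : Mul (Semi bd₁ N) where
  mul p q := ⟨p.fst * q.fst, bd₁ q.fst • p.snd + bd₁ p.fst • q.snd + p.snd * q.snd⟩

@[simp] theorem fst_add (p q : Semi bd₁ N) : (p + q).fst = p.fst + q.fst := rfl
@[simp] theorem snd_add (p q : Semi bd₁ N) : (p + q).snd = p.snd + q.snd := rfl
@[simp] theorem fst_zero : (0 : Semi bd₁ N).fst = 0 := rfl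
@[simp] theorem snd_zero : (0 : Semi bd₁ N).snd = 0 := rfl
@[simp] theorem fst_smul (a : A) (p : Semi bd₁ N) : (a • p).fst = a • p.fst := rfl
@[simp] theorem snd_smul (a : A) (p : Semi bd₁ N) : (a • p).snd = a • p.snd := rfl
@[simp] theorem fst_mul (p q : Semi bd₁ N) : (p * q).fst = p.fst * q.fst := rfl
@[simp] theorem snd_mul (p q : Semi bd₁ N) :
    (p * q).snd = bd₁ q.fst • p.snd + bd₁ p.fst • q.snd + p.snd * q.snd := rfl

instance : NonUnitalCommRing (Semi bd₁ N) where
  left_distrib x y z := by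
    ext
    · simp [mul_add]
    · simp only [snd_mul, snd_add, fst_add, map_add, add_smul, smul_add, mul_add]; abel
  right_distrib x y z := by
    ext
    · simp [add_mul]
    · simp only [snd_mul, snd_add, fst_add, map_add, add_smul, smul_add, add_mul]; abel
  zero_mul x := by ext <;> simp
  mul_zero x := by ext <;> simp
  mul_assoc x y z := by
    ext
    · simp [mul_assoc]
    · simp only [snd_mul, fst_mul, map_mul, smul_add, add_mul, mul_add, mul_smul, mul_assoc,
        smul_mul_assoc, mul_smul_comm]
      rw [smul_comm (bd₁ z.fst) (bd₁ y.fst), smul_comm (bd₁ z.fst) (bd₁ x.fst)]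
      abel
  mul_comm x y := by
    ext
    · simp [mul_comm]
    · simp only [snd_mul, mul_comm x.snd]; abel

/-- `(m, n) ↦ ∂₁ m + ∂₂ n` on `M ⋊ N`. -/
def bd (bd₁ : M →ₙₐ[A] A) (bd₂ : N →ₙₐ[A] A) : Semi bd₁ N →ₙₐ[A] A where
  toFun p := bd₁ p.fst + bd₂ p.snd
  map_smul' a x := by
    simp only [fst_smul, snd_smul, map_smul, smul_add, MonoidHom.id_apply]
  map_zero' := by simp
  map_add' x y := by simp only [fst_add, snd_add, map_add]; abel
  map_mul' x y := by simp only [fst_mul, snd_mul, map_mul, map_add, map_smul, smul_eq_mul]; ring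

end Semi

/-- The Peiffer ideal of `M ⋊ N`. -/
def coprodPeiffer (bd₁ : M →ₙₐ[A] A) (bd₂ : N →ₙₐ[A] A) : ActIdeal A (Semi bd₁ N) :=
  actSpan A {x | ∃ p q : Semi bd₁ N, x = p * q - Semi.bd bd₁ bd₂ p • q}

/-- The coproduct `M ⊔ N = (M ⋊ N) / P` of two crossed `A`-modules. -/
abbrev Coprod (bd₁ : M →ₙₐ[A] A) (bd₂ : N →ₙₐ[A] A) : Type v := (coprodPeiffer bd₁ bd₂).Quot

namespace Coprod

variable (bd₁ : M →ₙₐ[A] A) (bd₂ : N →ₙₐ[A] A)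

/-- The injection `i : M → M ⊔ N`. -/
def inl (m : M) : Coprod bd₁ bd₂ := (coprodPeiffer bd₁ bd₂).proj ⟨m, 0⟩

/-- The injection `j : N → M ⊔ N`. -/
def inr (n : N) : Coprod bd₁ bd₂ := (coprodPeiffer bd₁ bd₂).proj ⟨0, n⟩

/-- The boundary `M ⊔ N → A` induced by `∂₁ m + ∂₂ n`. -/
def bd : Coprod bd₁ bd₂ →ₙₐ[A] A :=
  (coprodPeiffer bd₁ bd₂).lift (Semi.bd bd₁ bd₂) (actSpan_le_ker _ (by
    rintro _ ⟨p, q, rfl⟩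
    rw [map_sub, map_mul, map_smul, smul_eq_mul, sub_self]))

end Coprod

end Coproduct

/-! ### Adjoining a crossed module to a tensor product of ideals -/

section Adjoin

variable (J I : Ideal A) {C : Type v} [NonUnitalCommRing C] [Module A C] [IsScalarTower A C C]
  [SMulCommClass A C C] (bdC : C →ₙₐ[A] A)

/-- The boundary `J ⊗ I → A`, `y ⊗ x ↦ y * x`. -/
abbrev idealTensorBd : (J ⊗[A] I) →ₙₐ[A] A := tensorBd (idealIncl J) (idealIncl I)

/-- The ideal of `(J ⊗ I) ⊔ C` generated by the relations
`i (n ⊗ ∂ c) ∼ j (n • c)` and `i (∂ c ⊗ m) ∼ j (m • c)` for `n ∈ J`, `m ∈ I`, `c ∈ C`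
(here `∂ C ⊆ J ∩ I`). -/
def adjoinRel (hJ : ∀ c, bdC c ∈ J) (hI : ∀ c, bdC c ∈ I) :
    ActIdeal A (Coprod (idealTensorBd J I) bdC) :=
  actSpan A
    ({z | ∃ (c : C) (n : J), z = Coprod.inl (idealTensorBd J I) bdC (n ⊗ₜ[A] ⟨bdC c, hI c⟩) -
        Coprod.inr (idealTensorBd J I) bdC ((n : A) • c)} ∪
     {z | ∃ (c : C) (m : I), z = Coprod.inl (idealTensorBd J I) bdC (⟨bdC c, hJ c⟩ ⊗ₜ[A] m) -
        Coprod.inr (idealTensorBd J I) bdC ((m : A) • c)})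

/-- The algebra `((J ⊗ I) ⊔ C) / ∼`. -/
abbrev Adjoin (hJ : ∀ c, bdC c ∈ J) (hI : ∀ c, bdC c ∈ I) : Type v := (adjoinRel J I bdC hJ hI).Quot

/-- The class of `i (t)`, for `t ∈ J ⊗ I`. -/
def Adjoin.inl (hJ : ∀ c, bdC c ∈ J) (hI : ∀ c, bdC c ∈ I) (t : J ⊗[A] I) :
    Adjoin J I bdC hJ hI :=
  (adjoinRel J I bdC hJ hI).proj (Coprod.inl (idealTensorBd J I) bdC t)

/-- The class of `j (c)`, for `c ∈ C`. -/
def Adjoin.inr (hJ : ∀ c, bdC c ∈ J) (hI : ∀ c, bdC c ∈ I) (c : C) :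
    Adjoin J I bdC hJ hI :=
  (adjoinRel J I bdC hJ hI).proj (Coprod.inr (idealTensorBd J I) bdC c)

/-- The boundary `((J ⊗ I) ⊔ C) / ∼ → A`. -/
def Adjoin.bd (hJ : ∀ c, bdC c ∈ J) (hI : ∀ c, bdC c ∈ I) : Adjoin J I bdC hJ hI →ₙₐ[A] A :=
  (adjoinRel J I bdC hJ hI).lift (Coprod.bd (idealTensorBd J I) bdC) (actSpan_le_ker _ (by
    have hl : ∀ t, Coprod.bd (idealTensorBd J I) bdC (Coprod.inl (idealTensorBd J I) bdC t) =
        idealTensorBd J I t := fun t => by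
      change idealTensorBd J I t + bdC 0 = _
      rw [map_zero, add_zero]
    have hr : ∀ c, Coprod.bd (idealTensorBd J I) bdC (Coprod.inr (idealTensorBd J I) bdC c) =
        bdC c := fun c => by
      change idealTensorBd J I 0 + bdC c = _
      rw [map_zero, zero_add]
    rintro _ (⟨c, n, rfl⟩ | ⟨c, m, rfl⟩)
    · rw [map_sub, hl, hr, map_smul, smul_eq_mul]
      exact sub_self ((n : A) * bdC c)
    · rw [map_sub, hl, hr, map_smul, smul_eq_mul, mul_comm]
      exact sub_self (bdC c * (m : A))))

end Adjoin

end CrossedModules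

/-! ### Simplicial commutative algebras -/

variable {k : Type u} [CommRing k]

/-- Face maps of a simplicial commutative `k`-algebra. -/
abbrev face (E : SimplicialObject (CommAlgCat.{v} k)) {n : ℕ} (i : Fin (n + 2)) :
    E _⦋n + 1⦌ →ₐ[k] E _⦋n⦌ := (E.δ i).hom

/-- Degeneracy maps of a simplicial commutative `k`-algebra. -/
abbrev degen (E : SimplicialObject (CommAlgCat.{v} k)) {n : ℕ} (i : Fin (n + 1)) :
    E _⦋n⦌ →ₐ[k] E _⦋n + 1⦌ := (E.σ i).hom

/-- Data exhibiting `E` as a free simplicial algebra (`step-by-step' construction): for every `m`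
a family of new generators in dimension `m + 1`, all of whose faces except the last vanish, such
that each `Eₙ` is the polynomial `E₀`-algebra on all the iterated degeneracies (including the
identical one) of the generators. -/
structure FreeData (E : SimplicialObject (CommAlgCat.{v} k)) where
  gen : ℕ → Type v
  ι : ∀ {m : ℕ}, gen m → E _⦋m + 1⦌
  face_ι : ∀ {m : ℕ} (x : gen m) (i : Fin (m + 2)), i ≠ Fin.last (m + 1) → face E i (ι x) = 0
  free : ∀ n : ℕ, Function.Bijective
    (MvPolynomial.eval₂Hom
      (E.map (SimplexCategory.const ⦋n⦌ ⦋0⦌ 0).op).hom.toRingHom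
      (fun p : (Σ m : ℕ, {s : ⦋n⦌ ⟶ ⦋m + 1⦌ // Epi s} × gen m) =>
        (E.map p.2.1.1.op).hom (ι p.2.2)))

/-- In degree `n`, the subalgebra of `Eₙ` generated by the images of the simplices of
dimension `≤ j`. -/
def skeletonAlg (E : SimplicialObject (CommAlgCat.{v} k)) (j : ℕ) (X : SimplexCategoryᵒᵖ) :
    Subalgebra k (E.obj X) :=
  Algebra.adjoin k {z | ∃ (i : ℕ) (_ : i ≤ j) (s : X.unop ⟶ ⦋i⦌) (y : E _⦋i⦌),
    (E.map s.op).hom y = z}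

theorem skeletonAlg_map (E : SimplicialObject (CommAlgCat.{v} k)) (j : ℕ)
    {X Y : SimplexCategoryᵒᵖ} (f : X ⟶ Y) (z : E.obj X) (hz : z ∈ skeletonAlg E j X) :
    (E.map f).hom z ∈ skeletonAlg E j Y := by
  have h : skeletonAlg E j X ≤ (skeletonAlg E j Y).comap (E.map f).hom := by
    refine Algebra.adjoin_le ?_
    rintro _ ⟨i, hi, s, y, rfl⟩
    refine Algebra.subset_adjoin ⟨i, hi, f.unop ≫ s, y, ?_⟩
    rw [op_comp, E.map_comp]
    rfl
  exact h hz

/-- The `j`-skeleton of a (free) simplicial algebra, as the simplicial subalgebra generated by the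
simplices of dimension `≤ j`. -/
def skeleton (E : SimplicialObject (CommAlgCat.{v} k)) (j : ℕ) :
    SimplicialObject (CommAlgCat.{v} k) where
  obj X := CommAlgCat.of k (skeletonAlg E j X)
  map {X Y} f := CommAlgCat.ofHom
    (((E.map f).hom.comp (skeletonAlg E j X).val).codRestrict (skeletonAlg E j Y)
      (fun z => skeletonAlg_map E j f z z.2))
  map_id X := by
    ext z
    change (E.map (𝟙 X)).hom (z : E.obj X) = z
    rw [E.map_id]
    rfl
  map_comp f g := by
    ext z
    change (E.map (f ≫ g)).hom (z : E.obj _) = (E.map g).hom ((E.map f).hom (z : E.obj _))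
    rw [E.map_comp]
    rfl

/-- A simplex of dimension `i ≤ j`, seen as a simplex of the `j`-skeleton. -/
def toSkeleton (E : SimplicialObject (CommAlgCat.{v} k)) {i j : ℕ} (h : i ≤ j) (y : E _⦋i⦌) :
    skeleton E j _⦋i⦌ :=
  ⟨y, Algebra.subset_adjoin ⟨i, h, 𝟙 _, y, by rw [op_id, E.map_id]; rfl⟩⟩

section TwoCrossed

variable (E : SimplicialObject (CommAlgCat.{v} k))

/-- `Ker dᵢ¹`, an ideal of `E₁`. -/
abbrev kerFace (i : Fin 2) : Ideal (E _⦋1⦌) := RingHom.ker (face E i)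

/-- The term `NE_{n+1} = ⋂_{i ≤ n} Ker dᵢ` of the Moore complex, an ideal of `E_{n+1}`. -/
def moore (n : ℕ) : Ideal (E _⦋n + 1⦌) := ⨅ i : Fin (n + 1), RingHom.ker (face E i.castSucc)

/-- `D_{n+1}`, the subalgebra of `E_{n+1}` generated by the degenerate elements. -/
def degenerate (n : ℕ) : Subalgebra k (E _⦋n + 1⦌) :=
  Algebra.adjoin k {z | ∃ (i : Fin (n + 1)) (y : E _⦋n⦌), degen E i y = z}

theorem mem_moore {n : ℕ} {x : E _⦋n + 1⦌} :
    x ∈ moore E n ↔ ∀ i : Fin (n + 1), face E i.castSucc x = 0 := by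
  simp [moore, RingHom.mem_ker]

/-- `∂₃(NE₃ ∩ D₃)`, an ideal of `E₂`. -/
def boundaryIdeal : Ideal (E _⦋2⦌) where
  carrier := {z | ∃ w ∈ moore E 2, w ∈ degenerate E 2 ∧ face E (Fin.last 3) w = z}
  add_mem' := by
    rintro _ _ ⟨w, h, h', rfl⟩ ⟨w₂, h₂, h₂', rfl⟩
    exact ⟨w + w₂, add_mem h h₂, add_mem h' h₂', map_add _ _ _⟩
  zero_mem' := ⟨0, zero_mem _, zero_mem _, map_zero _⟩
  smul_mem' := by
    rintro c _ ⟨w, h, h', rfl⟩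
    refine ⟨degen E (Fin.last 2) c * w, Ideal.mul_mem_left _ _ h,
      mul_mem (Algebra.subset_adjoin ⟨_, c, rfl⟩) h', ?_⟩
    rw [map_mul]
    have h1 : face E (Fin.last 3) (degen E (Fin.last 2) c) = c := by
      have := E.δ_comp_σ_succ (i := Fin.last 2)
      exact congrArg (fun f => f.hom c) this
    rw [h1, smul_eq_mul]

/-- `NE₂ / ∂₃(NE₃ ∩ D₃)`, as the image of the ideal `NE₂` in `E₂ / ∂₃(NE₃ ∩ D₃)`. -/
def c2Ideal : Ideal (E _⦋2⦌ ⧸ boundaryIdeal E) :=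
  (moore E 1).map (Ideal.Quotient.mk (boundaryIdeal E))

/-- The degree-two term `NE₂ / ∂₃(NE₃ ∩ D₃)` of the 2-crossed complex of `E`. -/
def C2 : Type v := c2Ideal E

namespace C2

instance : NonUnitalCommRing (C2 E) := inferInstanceAs (NonUnitalCommRing (c2Ideal E))

/-- The class of an element of `NE₂`. -/
def mk (z : E _⦋2⦌) (hz : z ∈ moore E 1) : C2 E :=
  ⟨Ideal.Quotient.mk _ z, Ideal.mem_map_of_mem _ hz⟩

/-- `E₁` acts on `NE₂ / ∂₃(NE₃ ∩ D₃)` by multiplication through `s₁`. -/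
instance : Module (E _⦋1⦌) (C2 E) :=
  letI : Module (E _⦋2⦌ ⧸ boundaryIdeal E) (C2 E) :=
    inferInstanceAs (Module (E _⦋2⦌ ⧸ boundaryIdeal E) (c2Ideal E))
  Module.compHom (C2 E)
    ((Ideal.Quotient.mk (boundaryIdeal E)).comp (degen E (1 : Fin 2)).toRingHom)

theorem face_boundaryIdeal (z : E _⦋2⦌) (hz : z ∈ boundaryIdeal E) :
    face E (Fin.last 2) z = 0 := by
  obtain ⟨w, h, -, rfl⟩ := hz
  have h2 : face E (Fin.last 2).castSucc w = 0 := (mem_moore E).1 h _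
  have := E.δ_comp_δ_self (i := Fin.last 2)
  have h3 : face E (Fin.last 2) (face E (Fin.last 2).castSucc w) =
      face E (Fin.last 2) (face E (Fin.last 2).succ w) := congrArg (fun f => f.hom w) this
  rw [h2, map_zero] at h3
  exact h3.symm

/-- The boundary `∂₂ : NE₂ / ∂₃(NE₃ ∩ D₃) → E₁`, induced by `d₂`. -/
def bd : C2 E →ₙₐ[E _⦋1⦌] E _⦋1⦌ where
  toFun z := Ideal.Quotient.lift (boundaryIdeal E) (face E (Fin.last 2)).toRingHom
    (face_boundaryIdeal E) z.1
  map_smul' a z := by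
    have h1 : face E (Fin.last 2) (degen E (1 : Fin 2) a) = a := by
      have := E.δ_comp_σ_succ (i := (1 : Fin 2))
      exact congrArg (fun f => f.hom a) this
    obtain ⟨z, hz⟩ := z
    obtain ⟨y, rfl⟩ := Ideal.Quotient.mk_surjective z
    change face E (Fin.last 2) (degen E (1 : Fin 2) a * y) = a * face E (Fin.last 2) y
    rw [map_mul, h1]
  map_zero' := map_zero _
  map_add' x y := map_add _ x.1 y.1
  map_mul' x y := map_mul _ x.1 y.1

/-- For `x ∈ Ker d₀` and `y ∈ Ker d₁` in `E₁`, the element `s₁ x * (s₁ y - s₀ y)` is in `NE₂`. -/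
theorem pairing_mem (x : kerFace E 0) (y : kerFace E 1) :
    degen E (1 : Fin 2) (x : E _⦋1⦌) *
      (degen E (1 : Fin 2) (y : E _⦋1⦌) - degen E (0 : Fin 2) (y : E _⦋1⦌)) ∈ moore E 1 := by
  rw [mem_moore]
  intro i
  rw [map_mul, map_sub]
  fin_cases i
  · have h : face E (0 : Fin 3) (degen E (1 : Fin 2) (x : E _⦋1⦌)) =
        degen E (0 : Fin 1) (face E (0 : Fin 2) (x : E _⦋1⦌)) :=
      congrArg (fun f => f.hom (x : E _⦋1⦌))
        (E.δ_comp_σ_of_le (i := (0 : Fin 2)) (j := (0 : Fin 1)) (le_refl _))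
    have hx : face E (0 : Fin 2) (x : E _⦋1⦌) = 0 := x.2
    rw [hx, map_zero] at h
    exact mul_eq_zero_of_left h _
  · have h1 : face E (1 : Fin 3) (degen E (1 : Fin 2) (y : E _⦋1⦌)) = y :=
      congrArg (fun f => f.hom (y : E _⦋1⦌)) (E.δ_comp_σ_self (i := (1 : Fin 2)))
    have h0 : face E (1 : Fin 3) (degen E (0 : Fin 2) (y : E _⦋1⦌)) = y :=
      congrArg (fun f => f.hom (y : E _⦋1⦌)) (E.δ_comp_σ_succ (i := (0 : Fin 2)))
    exact mul_eq_zero_of_right _ (by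
      change face E (1 : Fin 3) _ - face E (1 : Fin 3) _ = 0
      rw [h1, h0, sub_self])

/-- The pairing `h(x, y) = s₁ x * (s₁ y - s₀ y) + ∂₃(NE₃ ∩ D₃)` for `x ∈ Ker d₀`, `y ∈ Ker d₁`. -/
def pairing (x : kerFace E 0) (y : kerFace E 1) : C2 E := mk E _ (pairing_mem E x y)

end C2

end TwoCrossed

namespace FreeData

variable {E : SimplicialObject (CommAlgCat.{v} k)} (F : FreeData E)

/-- A generator of dimension two, in the 2-skeleton. -/
def gen₂ (t : F.gen 1) : skeleton E 2 _⦋2⦌ := toSkeleton E le_rfl (F.ι t)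

theorem gen₂_mem (t : F.gen 1) : F.gen₂ t ∈ moore (skeleton E 2) 1 := by
  rw [mem_moore]
  intro i
  refine Subtype.ext ?_
  exact F.face_ι t i.castSucc (Fin.castSucc_lt_last i).ne

end FreeData

end SimpAlg

/-! Write A = X₁, J = ker d₁, I = ker d₀ in A, and B = ∂₃(NX₃ ∩ D₃). The skeleton enters only
through `IsTwoPresented`: X₂ is (A ⊗ A)[T], the tensor product taken over X₀ and the two copies of A
embedded by s₁ and s₀, while X₃ is generated by degenerate elements. Here T is empty for the
1-skeleton and is the set of two-dimensional generators for the 2-skeleton.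

Explicit elements of NX₃ ∩ D₃ put three families of products into B. They make the pairing an
algebra map on J ⊗ I (`C2.tensorHom`), make NX₂/B a crossed A-module, hence a target for the free
one C, and give the relations ∼ there. They also show that pairings and multiples of the generators
t span NX₂ modulo B (`IsTwoPresented.moore_one_le`), whence surjectivity.

For injectivity an additive left inverse is built on all of X₂ (`IsTwoPresented.exists_retraction`).
Its first component is a ⊗ b ↦ (s₀d₁b − b) ⊗ (a − s₀d₀a) on A ⊗ A, after killing T; its second is
the C-part of a ring map from X₂ to the unitization A ⊕ C with t ↦ ι t. Conversely to the above, B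
lies in the additive span of the three families (`IsTwoPresented.map_boundaryIdeal_eq_zero`), and on
these the two components cancel by the crossed module law and the relations ∼. Part (1) is the case
where C is trivial. -/

namespace SimpAlg

/-! ### Simplicial identities in dimensions at most three -/

section Identities

variable {k : Type u} [CommRing k] (X : SimplicialObject (CommAlgCat.{v} k))

theorem face_degen_castSucc {n : ℕ} (i : Fin (n + 1)) (z : X _⦋n⦌) :
    face X i.castSucc (degen X i z) = z :=
  congrArg (fun f => f.hom z) (X.δ_comp_σ_self (i := i))

theorem face_degen_succ {n : ℕ} (i : Fin (n + 1)) (z : X _⦋n⦌) :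
    face X i.succ (degen X i z) = z :=
  congrArg (fun f => f.hom z) (X.δ_comp_σ_succ (i := i))

theorem face_degen_of_le {n : ℕ} {i : Fin (n + 2)} {j : Fin (n + 1)} (h : i ≤ j.castSucc)
    (z : X _⦋n + 1⦌) : face X i.castSucc (degen X j.succ z) = degen X j (face X i z) :=
  congrArg (fun f => f.hom z) (X.δ_comp_σ_of_le h)

theorem face_degen_of_gt {n : ℕ} {i : Fin (n + 2)} {j : Fin (n + 1)} (h : j.castSucc < i)
    (z : X _⦋n + 1⦌) : face X i.succ (degen X j.castSucc z) = degen X j (face X i z) :=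
  congrArg (fun f => f.hom z) (X.δ_comp_σ_of_gt h)

theorem face_face {n : ℕ} {i j : Fin (n + 2)} (h : i ≤ j) (z : X _⦋n + 2⦌) :
    face X i (face X j.succ z) = face X j (face X i.castSucc z) :=
  congrArg (fun f => f.hom z) (X.δ_comp_δ h)

theorem degen_degen {n : ℕ} {i j : Fin (n + 1)} (h : i ≤ j) (z : X _⦋n⦌) :
    degen X i.castSucc (degen X j z) = degen X j.succ (degen X i z) :=
  congrArg (fun f => f.hom z) (X.σ_comp_σ h)

theorem d0s0₁ (z : X _⦋0⦌) : face X (0 : Fin 2) (degen X (0 : Fin 1) z) = z :=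
  face_degen_castSucc X 0 z

theorem d1s0₁ (z : X _⦋0⦌) : face X (1 : Fin 2) (degen X (0 : Fin 1) z) = z :=
  face_degen_succ X 0 z

theorem d0s0₂ (z : X _⦋1⦌) : face X (0 : Fin 3) (degen X (0 : Fin 2) z) = z :=
  face_degen_castSucc X 0 z

theorem d1s0₂ (z : X _⦋1⦌) : face X (1 : Fin 3) (degen X (0 : Fin 2) z) = z :=
  face_degen_succ X 0 z

theorem d1s1₂ (z : X _⦋1⦌) : face X (1 : Fin 3) (degen X (1 : Fin 2) z) = z :=
  face_degen_castSucc X 1 z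

theorem d2s1₂ (z : X _⦋1⦌) : face X (2 : Fin 3) (degen X (1 : Fin 2) z) = z :=
  face_degen_succ X 1 z

theorem d0s1₂ (z : X _⦋1⦌) : face X (0 : Fin 3) (degen X (1 : Fin 2) z) =
    degen X (0 : Fin 1) (face X (0 : Fin 2) z) :=
  face_degen_of_le X (i := 0) (j := 0) (by decide) z

theorem d2s0₂ (z : X _⦋1⦌) : face X (2 : Fin 3) (degen X (0 : Fin 2) z) =
    degen X (0 : Fin 1) (face X (1 : Fin 2) z) :=
  face_degen_of_gt X (i := 1) (j := 0) (by decide) z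

theorem d0s0₃ (z : X _⦋2⦌) : face X (0 : Fin 4) (degen X (0 : Fin 3) z) = z :=
  face_degen_castSucc X 0 z

theorem d1s0₃ (z : X _⦋2⦌) : face X (1 : Fin 4) (degen X (0 : Fin 3) z) = z :=
  face_degen_succ X 0 z

theorem d1s1₃ (z : X _⦋2⦌) : face X (1 : Fin 4) (degen X (1 : Fin 3) z) = z :=
  face_degen_castSucc X 1 z

theorem d2s1₃ (z : X _⦋2⦌) : face X (2 : Fin 4) (degen X (1 : Fin 3) z) = z :=
  face_degen_succ X 1 z

theorem d2s2₃ (z : X _⦋2⦌) : face X (2 : Fin 4) (degen X (2 : Fin 3) z) = z :=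
  face_degen_castSucc X 2 z

theorem d3s2₃ (z : X _⦋2⦌) : face X (3 : Fin 4) (degen X (2 : Fin 3) z) = z :=
  face_degen_succ X 2 z

theorem d0s1₃ (z : X _⦋2⦌) : face X (0 : Fin 4) (degen X (1 : Fin 3) z) =
    degen X (0 : Fin 2) (face X (0 : Fin 3) z) :=
  face_degen_of_le X (i := 0) (j := 0) (by decide) z

theorem d0s2₃ (z : X _⦋2⦌) : face X (0 : Fin 4) (degen X (2 : Fin 3) z) =
    degen X (1 : Fin 2) (face X (0 : Fin 3) z) :=
  face_degen_of_le X (i := 0) (j := 1) (by decide) z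

theorem d1s2₃ (z : X _⦋2⦌) : face X (1 : Fin 4) (degen X (2 : Fin 3) z) =
    degen X (1 : Fin 2) (face X (1 : Fin 3) z) :=
  face_degen_of_le X (i := 1) (j := 1) (by decide) z

theorem d2s0₃ (z : X _⦋2⦌) : face X (2 : Fin 4) (degen X (0 : Fin 3) z) =
    degen X (0 : Fin 2) (face X (1 : Fin 3) z) :=
  face_degen_of_gt X (i := 1) (j := 0) (by decide) z

theorem d3s0₃ (z : X _⦋2⦌) : face X (3 : Fin 4) (degen X (0 : Fin 3) z) =
    degen X (0 : Fin 2) (face X (2 : Fin 3) z) :=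
  face_degen_of_gt X (i := 2) (j := 0) (by decide) z

theorem d3s1₃ (z : X _⦋2⦌) : face X (3 : Fin 4) (degen X (1 : Fin 3) z) =
    degen X (1 : Fin 2) (face X (2 : Fin 3) z) :=
  face_degen_of_gt X (i := 2) (j := 1) (by decide) z

theorem d0d2₂ (z : X _⦋2⦌) : face X (0 : Fin 2) (face X (2 : Fin 3) z) =
    face X (1 : Fin 2) (face X (0 : Fin 3) z) :=
  face_face X (i := 0) (j := 1) (by decide) z

theorem d1d2₂ (z : X _⦋2⦌) : face X (1 : Fin 2) (face X (2 : Fin 3) z) =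
    face X (1 : Fin 2) (face X (1 : Fin 3) z) :=
  face_face X (i := 1) (j := 1) le_rfl z

theorem d1d2₃ (z : X _⦋3⦌) : face X (1 : Fin 3) (face X (2 : Fin 4) z) =
    face X (1 : Fin 3) (face X (1 : Fin 4) z) :=
  face_face X (i := 1) (j := 1) le_rfl z

theorem d1d3₃ (z : X _⦋3⦌) : face X (1 : Fin 3) (face X (3 : Fin 4) z) =
    face X (2 : Fin 3) (face X (1 : Fin 4) z) :=
  face_face X (i := 1) (j := 2) (by decide) z

theorem d2d3₃ (z : X _⦋3⦌) : face X (2 : Fin 3) (face X (3 : Fin 4) z) =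
    face X (2 : Fin 3) (face X (2 : Fin 4) z) :=
  face_face X (i := 2) (j := 2) le_rfl z

theorem s1s0₂ (z : X _⦋0⦌) : degen X (1 : Fin 2) (degen X (0 : Fin 1) z) =
    degen X (0 : Fin 2) (degen X (0 : Fin 1) z) :=
  (degen_degen X (i := 0) (j := 0) le_rfl z).symm

theorem s1s0₃ (z : X _⦋1⦌) : degen X (1 : Fin 3) (degen X (0 : Fin 2) z) =
    degen X (0 : Fin 3) (degen X (0 : Fin 2) z) :=
  (degen_degen X (i := 0) (j := 0) le_rfl z).symm

theorem s2s0₃ (z : X _⦋1⦌) : degen X (2 : Fin 3) (degen X (0 : Fin 2) z) =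
    degen X (0 : Fin 3) (degen X (1 : Fin 2) z) :=
  (degen_degen X (i := 0) (j := 1) (by decide) z).symm

theorem s2s1₃ (z : X _⦋1⦌) : degen X (2 : Fin 3) (degen X (1 : Fin 2) z) =
    degen X (1 : Fin 3) (degen X (1 : Fin 2) z) :=
  (degen_degen X (i := 1) (j := 1) le_rfl z).symm

end Identities

/-! ### Three families of products in ∂₃(NX₃ ∩ D₃) -/

section Lifts

variable {k : Type u} [CommRing k] (X : SimplicialObject (CommAlgCat.{v} k))

theorem mem_moore_one {z : X _⦋2⦌} :
    z ∈ moore X 1 ↔ face X (0 : Fin 3) z = 0 ∧ face X (1 : Fin 3) z = 0 := by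
  rw [mem_moore, Fin.forall_fin_two]
  rfl

theorem mem_moore_two {w : X _⦋3⦌} :
    w ∈ moore X 2 ↔
      face X (0 : Fin 4) w = 0 ∧ face X (1 : Fin 4) w = 0 ∧ face X (2 : Fin 4) w = 0 := by
  rw [mem_moore, Fin.forall_fin_succ, Fin.forall_fin_two]
  rfl

theorem degen_mem_degenerate {n : ℕ} (i : Fin (n + 1)) (z : X _⦋n⦌) :
    degen X i z ∈ degenerate X n :=
  Algebra.subset_adjoin ⟨i, z, rfl⟩

theorem mem_boundaryIdeal {w : X _⦋3⦌} (h : w ∈ degenerate X 2)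
    (h0 : face X (0 : Fin 4) w = 0) (h1 : face X (1 : Fin 4) w = 0)
    (h2 : face X (2 : Fin 4) w = 0) : face X (3 : Fin 4) w ∈ boundaryIdeal X :=
  ⟨w, (mem_moore_two X).2 ⟨h0, h1, h2⟩, h, rfl⟩

/-- The lift is s₂s₁x (s₂z − s₁z + s₀z): d₀ kills the first factor, d₁ and d₂ kill the second,
because d₁z = 0. Since d₂z = 0, applying d₃ leaves s₁x · z. -/
theorem degen_mul_mem_boundaryIdeal {x : X _⦋1⦌} (hx : face X (0 : Fin 2) x = 0) {z : X _⦋2⦌}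
    (h1 : face X (1 : Fin 3) z = 0) (h2 : face X (2 : Fin 3) z = 0) :
    degen X (1 : Fin 2) x * z ∈ boundaryIdeal X := by
  have h := mem_boundaryIdeal X (w := degen X (2 : Fin 3) (degen X (1 : Fin 2) x) *
      (degen X (2 : Fin 3) z - degen X (1 : Fin 3) z + degen X (0 : Fin 3) z))
    (mul_mem (degen_mem_degenerate X _ _) (add_mem (sub_mem (degen_mem_degenerate X _ _)
      (degen_mem_degenerate X _ _)) (degen_mem_degenerate X _ _)))
    (by rw [map_mul, d0s2₃, d0s1₂, hx]; simp)
    (by simp only [map_mul, map_add, map_sub, d1s2₃, d1s1₃, d1s0₃, h1]; simp)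
    (by simp only [map_mul, map_add, map_sub, d2s2₃, d2s1₃, d2s0₃, h1]; simp)
  simpa only [map_mul, map_add, map_sub, d3s2₃, d3s1₃, d3s0₃, h2, map_zero, sub_zero,
    add_zero] using h

/-- Lift by s₂z (s₂w − s₁w): d₀ and d₁ kill s₂z, d₂ kills the difference, and d₃ turns it into w −
s₁d₂w = w. -/
theorem moore_mul_mem_boundaryIdeal {z w : X _⦋2⦌} (hz : z ∈ moore X 1)
    (hw : face X (2 : Fin 3) w = 0) : z * w ∈ boundaryIdeal X := by
  obtain ⟨h0, h1⟩ := (mem_moore_one X).1 hz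
  have h := mem_boundaryIdeal X
    (w := degen X (2 : Fin 3) z * (degen X (2 : Fin 3) w - degen X (1 : Fin 3) w))
    (mul_mem (degen_mem_degenerate X _ _) (sub_mem (degen_mem_degenerate X _ _)
      (degen_mem_degenerate X _ _)))
    (by rw [map_mul, d0s2₃, h0]; simp)
    (by rw [map_mul, d1s2₃, h1]; simp)
    (by simp only [map_mul, map_sub, d2s2₃, d2s1₃]; simp)
  simpa only [map_mul, map_sub, d3s2₃, d3s1₃, hw, map_zero, sub_zero] using h

/-- Lift by (s₁z − s₂z) s₂w. For w in NX₂ this is the crossed module law; only d₁w = 0 is asked so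
that w = s₁y − s₀y is allowed as well. -/
theorem peiffer_mem_boundaryIdeal {z w : X _⦋2⦌} (hz : z ∈ moore X 1)
    (hw : face X (1 : Fin 3) w = 0) :
    (degen X (1 : Fin 2) (face X (2 : Fin 3) z) - z) * w ∈ boundaryIdeal X := by
  obtain ⟨h0, h1⟩ := (mem_moore_one X).1 hz
  have h := mem_boundaryIdeal X
    (w := (degen X (1 : Fin 3) z - degen X (2 : Fin 3) z) * degen X (2 : Fin 3) w)
    (mul_mem (sub_mem (degen_mem_degenerate X _ _) (degen_mem_degenerate X _ _))
      (degen_mem_degenerate X _ _))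
    (by rw [map_mul, map_sub, d0s1₃, d0s2₃, h0]; simp)
    (by rw [map_mul, d1s2₃, hw]; simp)
    (by simp only [map_mul, map_sub, d2s2₃, d2s1₃]; simp)
  simpa only [map_mul, map_sub, d3s2₃, d3s1₃] using h

end Lifts

/-! ### Two-presented simplicial algebras: generators of NX₂ and of the boundary ideal -/

/-- A presentation of a simplicial algebra in low dimensions, without generators that are
nondegenerate of dimension three: the algebra of 2-simplices is the coproduct over `X₀` of two
copies of `X₁` (embedded by the degeneracies) with a polynomial algebra on generators `t`, whose
faces other than the last vanish. -/
structure IsTwoPresented {k : Type u} [CommRing k] (X : SimplicialObject (CommAlgCat.{v} k))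
    {T : Type v} (t : T → X _⦋2⦌) : Prop where
  face_zero : ∀ τ, face X (0 : Fin 3) (t τ) = 0
  face_one : ∀ τ, face X (1 : Fin 3) (t τ) = 0
  gen_two : ∀ H : Subring (X _⦋2⦌), (∀ a, degen X (1 : Fin 2) a ∈ H) →
    (∀ a, degen X (0 : Fin 2) a ∈ H) → (∀ τ, t τ ∈ H) → ∀ z, z ∈ H
  gen_three : ∀ H : Subring (X _⦋3⦌), (∀ (i : Fin 3) (y : X _⦋2⦌), degen X i y ∈ H) → ∀ z, z ∈ H
  exists_hom : ∀ (S : Type v) [CommRing S] (α β : X _⦋1⦌ →+* S) (γ : T → S),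
    (∀ r, α (degen X (0 : Fin 1) r) = β (degen X (0 : Fin 1) r)) →
      ∃ θ : X _⦋2⦌ →+* S, (∀ a, θ (degen X (1 : Fin 2) a) = α a) ∧
        (∀ a, θ (degen X (0 : Fin 2) a) = β a) ∧ ∀ τ, θ (t τ) = γ τ

namespace IsTwoPresented

variable {k : Type u} [CommRing k] {X : SimplicialObject (CommAlgCat.{v} k)}
  {T : Type v} {t : T → X _⦋2⦌} (P : IsTwoPresented X t)

include P

theorem ringHom_ext_two {S : Type*} [Ring S] {f g : X _⦋2⦌ →+* S}
    (h1 : ∀ a, f (degen X (1 : Fin 2) a) = g (degen X (1 : Fin 2) a))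
    (h0 : ∀ a, f (degen X (0 : Fin 2) a) = g (degen X (0 : Fin 2) a))
    (ht : ∀ τ, f (t τ) = g (t τ)) (z : X _⦋2⦌) : f z = g z :=
  P.gen_two (f.eqLocus g) h1 h0 ht z

/-- The identities s₁s₁ = s₂s₁, s₁s₀ = s₀s₀ and s₂s₀ = s₀s₁ reduce the degenerate generators of X₃
to the four families tested here. -/
theorem ringHom_ext_three {S : Type*} [Ring S] {f g : X _⦋3⦌ →+* S}
    (h : ∀ a, f (degen X (2 : Fin 3) (degen X (1 : Fin 2) a)) =
      g (degen X (2 : Fin 3) (degen X (1 : Fin 2) a)))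
    (h0 : ∀ z, f (degen X (0 : Fin 3) z) = g (degen X (0 : Fin 3) z))
    (h1 : ∀ τ, f (degen X (1 : Fin 3) (t τ)) = g (degen X (1 : Fin 3) (t τ)))
    (h2 : ∀ τ, f (degen X (2 : Fin 3) (t τ)) = g (degen X (2 : Fin 3) (t τ))) (z : X _⦋3⦌) :
    f z = g z := by
  refine P.gen_three (f.eqLocus g) (fun i y => ?_) z
  fin_cases i
  · exact h0 y
  · refine P.ringHom_ext_two (f := f.comp (degen X (1 : Fin 3)).toRingHom)
      (g := g.comp (degen X (1 : Fin 3)).toRingHom) (fun a => ?_) (fun a => ?_) h1 y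
    · change f (degen X (1 : Fin 3) (degen X (1 : Fin 2) a)) =
        g (degen X (1 : Fin 3) (degen X (1 : Fin 2) a))
      rw [← s2s1₃, h]
    · change f (degen X (1 : Fin 3) (degen X (0 : Fin 2) a)) =
        g (degen X (1 : Fin 3) (degen X (0 : Fin 2) a))
      rw [s1s0₃, h0]
  · refine P.ringHom_ext_two (f := f.comp (degen X (2 : Fin 3)).toRingHom)
      (g := g.comp (degen X (2 : Fin 3)).toRingHom) h (fun a => ?_) h2 y
    change f (degen X (2 : Fin 3) (degen X (0 : Fin 2) a)) =
      g (degen X (2 : Fin 3) (degen X (0 : Fin 2) a))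
    rw [s2s0₃, h0]

/-- As s₀ splits d₀, the kernel of d₀ is the ideal generated by the g − s₀d₀g for g in a set of ring
generators. For g = s₁a this is s₁(a − s₀d₀a), for g = s₀a it is 0, for g = t it is t. The same
argument works one dimension higher. -/
theorem mem_span_of_face_zero_two {z : X _⦋2⦌} (hz : face X (0 : Fin 3) z = 0) :
    z ∈ Ideal.span ({z | ∃ x : X _⦋1⦌, face X (0 : Fin 2) x = 0 ∧ degen X (1 : Fin 2) x = z} ∪
      Set.range t) := by
  set L := Ideal.span ({z | ∃ x : X _⦋1⦌, face X (0 : Fin 2) x = 0 ∧ degen X (1 : Fin 2) x = z} ∪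
      Set.range t) with hL
  have h := P.ringHom_ext_two (f := Ideal.Quotient.mk L) (g := (Ideal.Quotient.mk L).comp
    ((degen X (0 : Fin 2)).comp (face X (0 : Fin 3))).toRingHom) (fun a => ?_) (fun a => ?_)
    (fun τ => ?_) z
  · rw [← Ideal.Quotient.eq_zero_iff_mem, h]
    change Ideal.Quotient.mk L (degen X (0 : Fin 2) (face X (0 : Fin 3) z)) = 0
    rw [hz, map_zero, map_zero]
  · refine Ideal.Quotient.eq.2 (Ideal.subset_span (Or.inl
      ⟨a - degen X (0 : Fin 1) (face X (0 : Fin 2) a), ?_, ?_⟩))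
    · rw [map_sub, d0s0₁, sub_self]
    · rw [map_sub, s1s0₂, ← d0s1₂]
      rfl
  · change _ = Ideal.Quotient.mk L (degen X (0 : Fin 2) (face X (0 : Fin 3) _))
    rw [d0s0₂]
  · refine Ideal.Quotient.eq.2 ?_
    change t τ - degen X (0 : Fin 2) (face X (0 : Fin 3) (t τ)) ∈ L
    rw [P.face_zero, map_zero, sub_zero]
    exact Ideal.subset_span (Or.inr ⟨τ, rfl⟩)

theorem mem_span_of_face_zero_three {z : X _⦋3⦌} (hz : face X (0 : Fin 4) z = 0) :
    z ∈ Ideal.span ({z | ∃ x : X _⦋1⦌, face X (0 : Fin 2) x = 0 ∧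
        degen X (2 : Fin 3) (degen X (1 : Fin 2) x) = z} ∪
      (Set.range (fun τ => degen X (1 : Fin 3) (t τ)) ∪
        Set.range (fun τ => degen X (2 : Fin 3) (t τ)))) := by
  set L := Ideal.span ({z | ∃ x : X _⦋1⦌, face X (0 : Fin 2) x = 0 ∧
        degen X (2 : Fin 3) (degen X (1 : Fin 2) x) = z} ∪
      (Set.range (fun τ => degen X (1 : Fin 3) (t τ)) ∪
        Set.range (fun τ => degen X (2 : Fin 3) (t τ)))) with hL
  have h := P.ringHom_ext_three (f := Ideal.Quotient.mk L) (g := (Ideal.Quotient.mk L).comp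
    ((degen X (0 : Fin 3)).comp (face X (0 : Fin 4))).toRingHom) (fun a => ?_) (fun a => ?_)
    (fun τ => ?_) (fun τ => ?_) z
  · rw [← Ideal.Quotient.eq_zero_iff_mem, h]
    change Ideal.Quotient.mk L (degen X (0 : Fin 3) (face X (0 : Fin 4) z)) = 0
    rw [hz, map_zero, map_zero]
  · refine Ideal.Quotient.eq.2 (Ideal.subset_span (Or.inl
      ⟨a - degen X (0 : Fin 1) (face X (0 : Fin 2) a), ?_, ?_⟩))
    · rw [map_sub, d0s0₁, sub_self]
    · rw [map_sub, map_sub, s1s0₂, s2s0₃, ← d0s1₂, ← d0s2₃]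
      rfl
  · change _ = Ideal.Quotient.mk L (degen X (0 : Fin 3) (face X (0 : Fin 4) _))
    rw [d0s0₃]
  · refine Ideal.Quotient.eq.2 ?_
    change degen X (1 : Fin 3) (t τ) -
      degen X (0 : Fin 3) (face X (0 : Fin 4) (degen X (1 : Fin 3) (t τ))) ∈ L
    rw [d0s1₃, P.face_zero, map_zero, map_zero, sub_zero]
    exact Ideal.subset_span (Or.inr (Or.inl ⟨τ, rfl⟩))
  · refine Ideal.Quotient.eq.2 ?_
    change degen X (2 : Fin 3) (t τ) -
      degen X (0 : Fin 3) (face X (0 : Fin 4) (degen X (2 : Fin 3) (t τ))) ∈ L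
    rw [d0s2₃, P.face_zero, map_zero, map_zero, sub_zero]
    exact Ideal.subset_span (Or.inr (Or.inr ⟨τ, rfl⟩))

/-- The elements of `NE₂` are, up to `∂₃(NE₃ ∩ D₃)`, sums of pairings and multiples of the
generators. -/
theorem moore_one_le (H : AddSubgroup (X _⦋2⦌)) (hb : ∀ z ∈ boundaryIdeal X, z ∈ H)
    (hp : ∀ x y : X _⦋1⦌, face X (0 : Fin 2) x = 0 → face X (1 : Fin 2) y = 0 →
      degen X (1 : Fin 2) x * (degen X (1 : Fin 2) y - degen X (0 : Fin 2) y) ∈ H)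
    (ht : ∀ (a : X _⦋1⦌) τ, degen X (1 : Fin 2) a * t τ ∈ H) (z : X _⦋2⦌) (hz : z ∈ moore X 1) :
    z ∈ H := by
  obtain ⟨h0, h1⟩ := (mem_moore_one X).1 hz
  -- The additive operator z ↦ z − s₁d₁z is the identity on NX₂ but is defined on all of ker d₀, so
  -- it can be evaluated on each multiple of an ideal generator separately.
  suffices h : z - degen X (1 : Fin 2) (face X (1 : Fin 3) z) ∈ H by
    rwa [h1, map_zero, sub_zero] at h
  refine Submodule.closure_induction
    (p := fun z _ => z - degen X (1 : Fin 2) (face X (1 : Fin 3) z) ∈ H) ?_ ?_ ?_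
    (P.mem_span_of_face_zero_two h0)
  · simp
  · intro x y _ _ hx hy
    rw [map_add, map_add, add_sub_add_comm]
    exact add_mem hx hy
  · rintro f _ (⟨x, hx, rfl⟩ | ⟨τ, rfl⟩)
    -- The operator sends f · s₁x to g · s₁x with d₁g = 0. For y = d₂g, the elements g and s₁y − s₀y
    -- have the same d₁ and d₂, so modulo B the product is the pairing of x and y.
    · obtain ⟨g, hg⟩ : ∃ g, g = f - degen X (1 : Fin 2) (face X (1 : Fin 3) f) := ⟨_, rfl⟩
      have hg1 : face X (1 : Fin 3) g = 0 := by rw [hg, map_sub, d1s1₂, sub_self]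
      have hy : face X (1 : Fin 2) (face X (2 : Fin 3) g) = 0 := by rw [d1d2₂, hg1, map_zero]
      have h := add_mem (hb _ (degen_mul_mem_boundaryIdeal X hx
        (z := g - (degen X (1 : Fin 2) (face X (2 : Fin 3) g) -
          degen X (0 : Fin 2) (face X (2 : Fin 3) g)))
        (by rw [map_sub, map_sub, hg1, d1s1₂, d1s0₂]; simp)
        (by rw [map_sub, map_sub, d2s1₂, d2s0₂, hy]; simp))) (hp x _ hx hy)
      rw [← mul_add, sub_add_cancel, hg] at h
      rw [smul_eq_mul, map_mul, map_mul, d1s1₂, ← sub_mul, mul_comm]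
      exact h
    -- Modulo B the coefficient f of a generator may be replaced by s₁d₂f, since the difference lies
    -- in ker d₂.
    · have h := add_mem (hb _ (moore_mul_mem_boundaryIdeal X (z := t τ)
        (w := f - degen X (1 : Fin 2) (face X (2 : Fin 3) f))
        ((mem_moore_one X).2 ⟨P.face_zero τ, P.face_one τ⟩)
        (by rw [map_sub, d2s1₂, sub_self]))) (ht (face X (2 : Fin 3) f) τ)
      rw [mul_comm _ (t τ), ← mul_add, sub_add_cancel] at h
      rw [smul_eq_mul, map_mul, P.face_one, mul_zero, map_zero, sub_zero, mul_comm]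
      exact h

/-- An additive map on `E₂` kills `∂₃(NE₃)` as soon as it kills three families of products. -/
theorem map_boundaryIdeal_eq_zero {Q : Type*} [AddCommGroup Q] (ψ : X _⦋2⦌ →+ Q)
    (h01 : ∀ (x : X _⦋1⦌) (z : X _⦋2⦌), face X (0 : Fin 2) x = 0 → face X (1 : Fin 3) z = 0 →
      face X (2 : Fin 3) z = 0 → ψ (degen X (1 : Fin 2) x * z) = 0)
    (ht1 : ∀ τ (z : X _⦋2⦌), face X (1 : Fin 3) z = 0 →
      ψ ((degen X (1 : Fin 2) (face X (2 : Fin 3) (t τ)) - t τ) * z) = 0)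
    (ht2 : ∀ τ (z : X _⦋2⦌), face X (2 : Fin 3) z = 0 → ψ (t τ * z) = 0)
    (z : X _⦋2⦌) (hz : z ∈ boundaryIdeal X) : ψ z = 0 := by
  obtain ⟨w, hw, -, rfl⟩ := hz
  obtain ⟨h0, h1, h2⟩ := (mem_moore_two X).1 hw
  change ψ (face X (3 : Fin 4) w) = 0
  have key : ∀ {a b c : X _⦋2⦌}, ψ a = 0 → ψ b = 0 → c = a + b → ψ c = 0 := by
    rintro a b _ ha hb rfl
    rw [map_add, ha, hb, add_zero]
  -- On NX₃ the operator d₃ − d₂ + d₁ − s₁d₂d₁ agrees with d₃. Its values lie in ker d₁ ∩ ker d₂ for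
  -- every argument, so it can be computed on multiples of the generators of ker d₀.
  suffices h : ψ (face X (3 : Fin 4) w - face X (2 : Fin 4) w + face X (1 : Fin 4) w -
      degen X (1 : Fin 2) (face X (2 : Fin 3) (face X (1 : Fin 4) w))) = 0 by
    simpa only [h1, h2, map_zero, sub_zero, add_zero] using h
  refine Submodule.closure_induction
    (p := fun w _ => ψ (face X (3 : Fin 4) w - face X (2 : Fin 4) w + face X (1 : Fin 4) w -
      degen X (1 : Fin 2) (face X (2 : Fin 3) (face X (1 : Fin 4) w))) = 0) ?_ ?_ ?_
    (P.mem_span_of_face_zero_three h0)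
  · simp
  · intro x y _ _ hx hy
    refine key hx hy ?_
    simp only [map_add]
    abel
  · intro f _ hm
    have hf1 : face X (1 : Fin 3) (face X (3 : Fin 4) f - face X (2 : Fin 4) f +
        face X (1 : Fin 4) f -
        degen X (1 : Fin 2) (face X (2 : Fin 3) (face X (1 : Fin 4) f))) = 0 := by
      rw [map_sub, map_add, map_sub, d1s1₂, d1d3₃, d1d2₃]; ring
    have hf2 : face X (2 : Fin 3) (face X (3 : Fin 4) f - face X (2 : Fin 4) f +
        face X (1 : Fin 4) f -
        degen X (1 : Fin 2) (face X (2 : Fin 3) (face X (1 : Fin 4) f))) = 0 := by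
      rw [map_sub, map_add, map_sub, d2s1₂, d2d3₃]; ring
    rcases hm with ⟨x, hx, rfl⟩ | ⟨τ, rfl⟩ | ⟨τ, rfl⟩
    · rw [← h01 x _ hx hf1 hf2]
      congr 1
      simp only [smul_eq_mul, map_mul, d3s2₃, d2s2₃, d1s2₃, d1s1₂, d2s1₂]
      ring
    · have hg1 : face X (1 : Fin 3) (face X (3 : Fin 4) f -
          degen X (1 : Fin 2) (face X (2 : Fin 3) (face X (1 : Fin 4) f))) = 0 := by
        rw [map_sub, d1s1₂, d1d3₃, sub_self]
      -- The value on f · s₁t is (s₁d₂t − t)(d₃f − s₁d₂d₁f) + t(d₃f − d₂f + d₁f − s₁d₂d₁f).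
      refine key (ht1 τ _ hg1) (ht2 τ _ hf2) ?_
      simp only [smul_eq_mul, map_mul, d3s1₃, d2s1₃, d1s1₃]
      ring
    · rw [← ht2 τ (face X (3 : Fin 4) f - face X (2 : Fin 4) f) (by rw [map_sub, d2d3₃, sub_self])]
      congr 1
      simp only [smul_eq_mul, map_mul, d3s2₃, d2s2₃, d1s2₃, P.face_one, map_zero, mul_zero]
      ring

end IsTwoPresented

/-! ### The degree-two term as a crossed module, and the pairing as an algebra map -/

namespace C2

variable {k : Type u} [CommRing k] (X : SimplicialObject (CommAlgCat.{v} k))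

theorem mk_surjective (c : C2 X) : ∃ (z : X _⦋2⦌) (hz : z ∈ moore X 1), mk X z hz = c := by
  obtain ⟨c, hc⟩ := c
  obtain ⟨z, hz, rfl⟩ := (Ideal.mem_map_iff_of_surjective _ Ideal.Quotient.mk_surjective).1 hc
  exact ⟨z, hz, rfl⟩

variable {X}

theorem mk_eq_mk {z w : X _⦋2⦌} {hz : z ∈ moore X 1} {hw : w ∈ moore X 1} :
    mk X z hz = mk X w hw ↔ z - w ∈ boundaryIdeal X :=
  Subtype.ext_iff.trans Ideal.Quotient.eq

theorem mk_congr {z w : X _⦋2⦌} {hz : z ∈ moore X 1} {hw : w ∈ moore X 1} (h : z = w) :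
    mk X z hz = mk X w hw :=
  mk_eq_mk.2 (by rw [h, sub_self]; exact zero_mem _)

theorem mk_add {z w : X _⦋2⦌} (hz : z ∈ moore X 1) (hw : w ∈ moore X 1) :
    mk X z hz + mk X w hw = mk X (z + w) (add_mem hz hw) := rfl

theorem mk_mul {z w : X _⦋2⦌} (hz : z ∈ moore X 1) (hw : w ∈ moore X 1) :
    mk X z hz * mk X w hw = mk X (z * w) (Ideal.mul_mem_left _ _ hw) := rfl

theorem smul_mk (a : X _⦋1⦌) {z : X _⦋2⦌} (hz : z ∈ moore X 1) :
    a • mk X z hz = mk X (degen X (1 : Fin 2) a * z) (Ideal.mul_mem_left _ _ hz) := rfl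

theorem bd_mk {z : X _⦋2⦌} (hz : z ∈ moore X 1) : bd X (mk X z hz) = face X (2 : Fin 3) z := rfl

instance : IsScalarTower (X _⦋1⦌) (C2 X) (C2 X) where
  smul_assoc a c c' := by
    obtain ⟨z, hz, rfl⟩ := mk_surjective X c
    obtain ⟨w, hw, rfl⟩ := mk_surjective X c'
    rw [smul_mk, smul_eq_mul, smul_eq_mul, mk_mul, mk_mul, smul_mk]
    exact mk_congr (by ring)

instance : SMulCommClass (X _⦋1⦌) (C2 X) (C2 X) where
  smul_comm a c c' := by
    obtain ⟨z, hz, rfl⟩ := mk_surjective X c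
    obtain ⟨w, hw, rfl⟩ := mk_surjective X c'
    rw [smul_mk, smul_eq_mul, smul_eq_mul, mk_mul, mk_mul, smul_mk]
    exact mk_congr (by ring)

variable (X)

theorem isCrossedModule : IsCrossedModule (bd X) := by
  intro c c'
  obtain ⟨z, hz, rfl⟩ := mk_surjective X c
  obtain ⟨w, hw, rfl⟩ := mk_surjective X c'
  rw [bd_mk, smul_mk, mk_mul, mk_eq_mk, ← sub_mul]
  exact peiffer_mem_boundaryIdeal X hz ((mem_moore_one X).1 hw).2

/-- The pairing as a bilinear map. -/
def pairingBilin : kerFace X 1 →ₗ[X _⦋1⦌] kerFace X 0 →ₗ[X _⦋1⦌] C2 X :=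
  LinearMap.mk₂ (X _⦋1⦌) (fun y x => pairing X x y)
    (fun y y' x => (mk_congr (by
      simp only [Submodule.coe_add, map_add]; ring) :
        mk X _ (pairing_mem X x (y + y')) = mk X _ _).trans (mk_add _ _).symm)
    -- Linearity in y holds only modulo B: the defect is s₁x (s₁a − s₀a) s₀y up to sign, whose
    -- second and third factors multiply into ker d₁ ∩ ker d₂. The other three conditions hold
    -- already in X₂.
    (fun a y x => by
      have hx : face X (0 : Fin 2) (x : X _⦋1⦌) = 0 := x.2
      have hy : face X (1 : Fin 2) (y : X _⦋1⦌) = 0 := y.2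
      rw [pairing, pairing, smul_mk, mk_eq_mk]
      have h := degen_mul_mem_boundaryIdeal X hx
        (z := (degen X (1 : Fin 2) a - degen X (0 : Fin 2) a) * degen X (0 : Fin 2) (y : X _⦋1⦌))
        (by rw [map_mul, map_sub, d1s1₂, d1s0₂, sub_self, zero_mul])
        (by rw [map_mul, d2s0₂ X (y : X _⦋1⦌), hy, map_zero, mul_zero])
      convert h using 1
      simp only [SetLike.val_smul, smul_eq_mul, map_mul]
      ring)
    (fun y x x' => (mk_congr (by
      simp only [Submodule.coe_add, map_add]; ring) :
        mk X _ (pairing_mem X (x + x') y) = mk X _ _).trans (mk_add _ _).symm)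
    (fun a y x => (mk_congr (by
      simp only [SetLike.val_smul, smul_eq_mul, map_mul]; ring) :
        mk X _ (pairing_mem X (a • x) y) = mk X _ _).trans (smul_mk _ _).symm)

/-- The difference of the two sides is s₁(xx') times (s₁y − s₀y) s₀y' + s₀y (s₁y' − s₀y'), and this
sum lies in ker d₁ ∩ ker d₂. -/
theorem pairing_mul_pairing (x x' : kerFace X 0) (y y' : kerFace X 1) :
    pairing X (x * x') (y * y') = pairing X x y * pairing X x' y' := by
  have hx : face X (0 : Fin 2) ((x * x' : kerFace X 0) : X _⦋1⦌) = 0 := (x * x').2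
  have hy : face X (1 : Fin 2) (y : X _⦋1⦌) = 0 := y.2
  have hy' : face X (1 : Fin 2) (y' : X _⦋1⦌) = 0 := y'.2
  rw [pairing, pairing, pairing, mk_mul, mk_eq_mk]
  have h := degen_mul_mem_boundaryIdeal X hx
    (z := (degen X (1 : Fin 2) (y : X _⦋1⦌) - degen X (0 : Fin 2) (y : X _⦋1⦌)) *
        degen X (0 : Fin 2) (y' : X _⦋1⦌) + degen X (0 : Fin 2) (y : X _⦋1⦌) *
        (degen X (1 : Fin 2) (y' : X _⦋1⦌) - degen X (0 : Fin 2) (y' : X _⦋1⦌)))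
    (by simp only [map_add, map_mul, map_sub, d1s1₂, d1s0₂, sub_self, zero_mul, mul_zero, add_zero])
    (by simp only [map_add, map_mul, d2s0₂, hy, hy', map_zero, zero_mul, mul_zero, add_zero])
  convert h using 1
  simp only [MulMemClass.coe_mul, map_mul]
  ring

/-- The map `J ⊗ I → NE₂ / ∂₃(NE₃ ∩ D₃)` induced by the pairing. -/
def tensorHom : (kerFace X 1 ⊗[X _⦋1⦌] kerFace X 0) →ₙₐ[X _⦋1⦌] C2 X where
  toFun := TensorProduct.lift (pairingBilin X)
  map_smul' a s := map_smul _ a s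
  map_zero' := map_zero _
  map_add' s s' := map_add _ s s'
  map_mul' s s' := by
    induction s with
    | zero => rw [zero_mul, map_zero, zero_mul]
    | add a b ha hb => rw [add_mul, map_add, map_add, ha, hb, add_mul]
    | tmul y x =>
      induction s' with
      | zero => rw [mul_zero, map_zero, mul_zero]
      | add a b ha hb => rw [mul_add, map_add, map_add, ha, hb, mul_add]
      | tmul y' x' =>
        rw [Algebra.TensorProduct.tmul_mul_tmul]
        exact pairing_mul_pairing X x x' y y'

theorem tensorHom_tmul (y : kerFace X 1) (x : kerFace X 0) :
    tensorHom X (y ⊗ₜ x) = pairing X x y := rfl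

theorem bd_pairing (x : kerFace X 0) (y : kerFace X 1) :
    bd X (pairing X x y) = (y : X _⦋1⦌) * x := by
  have hy : face X (1 : Fin 2) (y : X _⦋1⦌) = 0 := y.2
  rw [pairing, bd_mk, map_mul, map_sub, d2s1₂ X (x : X _⦋1⦌), d2s1₂ X (y : X _⦋1⦌),
    d2s0₂ X (y : X _⦋1⦌), hy, map_zero, sub_zero, mul_comm]

theorem bd_tensorHom (s : kerFace X 1 ⊗[X _⦋1⦌] kerFace X 0) :
    bd X (tensorHom X s) = idealTensorBd (kerFace X 1) (kerFace X 0) s := by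
  induction s with
  | zero => rw [map_zero, map_zero, map_zero]
  | add a b ha hb => rw [map_add, map_add, ha, hb, map_add]
  | tmul y x => exact bd_pairing X x y

end C2

/-! ### The additive retraction of X₂ onto the tensor product and the crossed module -/

section Pushout

/-- The algebra `S = A ⊗ A` over `R`, in terms of its universal properties, with the additive map
`S → J ⊗ I` which is a retraction of the pairing. -/
theorem exists_pushout_retraction {R A : Type v} [CommRing R] [CommRing A] [Algebra R A]
    (d₀ d₁ : A →ₐ[R] R) (J I : Ideal A) (hJ : ∀ a, a ∈ J ↔ d₁ a = 0) (hI : ∀ a, a ∈ I ↔ d₀ a = 0) :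
    ∃ (S : Type v) (_ : CommRing S) (l r : A →+* S) (p q : S →+* A) (μ : S →+ J ⊗[A] I),
      (∀ a, l (algebraMap R A a) = r (algebraMap R A a)) ∧ (∀ a, p (l a) = a) ∧
      (∀ a, p (r a) = a) ∧ (∀ a, q (l a) = a) ∧ (∀ a, q (r a) = algebraMap R A (d₁ a)) ∧
      ∀ (x : I) (s : S) (n : J), (n : A) = q s - p s → μ (l x * s) = n ⊗ₜ x := by
  let toJ : A →+ J :=
    { toFun := fun b => ⟨algebraMap R A (d₁ b) - b, by
        rw [hJ, map_sub, AlgHom.commutes, Algebra.algebraMap_self_apply, sub_self]⟩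
      map_zero' := Subtype.ext (by simp)
      map_add' := fun a b => Subtype.ext (by
        simp only [map_add, Submodule.coe_add]; ring) }
  let toI : A →+ I :=
    { toFun := fun b => ⟨b - algebraMap R A (d₀ b), by
        rw [hI, map_sub, AlgHom.commutes, Algebra.algebraMap_self_apply, sub_self]⟩
      map_zero' := Subtype.ext (by simp)
      map_add' := fun a b => Subtype.ext (by
        simp only [map_add, Submodule.coe_add]; ring) }
  have hToJ : ∀ (c : R) b, toJ (c • b) = algebraMap R A c • toJ b := fun c b =>
    Subtype.ext (by
      change algebraMap R A (d₁ (c • b)) - c • b = algebraMap R A c * (algebraMap R A (d₁ b) - b)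
      simp only [Algebra.smul_def, map_mul, AlgHom.commutes, Algebra.algebraMap_self_apply]; ring)
  have hToI : ∀ (c : R) b, toI (c • b) = algebraMap R A c • toI b := fun c b =>
    Subtype.ext (by
      change c • b - algebraMap R A (d₀ (c • b)) = algebraMap R A c * (b - algebraMap R A (d₀ b))
      simp only [Algebra.smul_def, map_mul, AlgHom.commutes, Algebra.algebraMap_self_apply]; ring)
  let f : A →+ A →+ J ⊗[A] I :=
    { toFun := fun a =>
        { toFun := fun b => toJ b ⊗ₜ toI a
          map_zero' := by rw [map_zero, TensorProduct.zero_tmul]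
          map_add' := fun b b' => by rw [map_add, TensorProduct.add_tmul] }
      map_zero' := AddMonoidHom.ext fun b => by
        change toJ b ⊗ₜ toI 0 = 0
        rw [map_zero, TensorProduct.tmul_zero]
      map_add' := fun a a' => AddMonoidHom.ext fun b => by
        change toJ b ⊗ₜ toI (a + a') = toJ b ⊗ₜ toI a + toJ b ⊗ₜ toI a'
        rw [map_add, TensorProduct.tmul_add] }
  -- The map a ⊗ b ↦ (d₁b − b) ⊗ (a − d₀a), with R mapped into A; it is balanced because both
  -- projections are R-linear.
  let μ : A ⊗[R] A →+ J ⊗[A] I := TensorProduct.liftAddHom f (fun c a b => by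
    change toJ b ⊗ₜ toI (c • a) = toJ (c • b) ⊗ₜ toI a
    rw [hToJ, hToI, TensorProduct.smul_tmul])
  let p : A ⊗[R] A →ₐ[R] A := Algebra.TensorProduct.productMap (AlgHom.id R A) (AlgHom.id R A)
  let q : A ⊗[R] A →ₐ[R] A :=
    Algebra.TensorProduct.productMap (AlgHom.id R A) ((Algebra.ofId R A).comp d₁)
  refine ⟨A ⊗[R] A, inferInstance,
    (Algebra.TensorProduct.includeLeft : A →ₐ[R] A ⊗[R] A).toRingHom,
    (Algebra.TensorProduct.includeRight : A →ₐ[R] A ⊗[R] A).toRingHom,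
    p.toRingHom, q.toRingHom, μ, fun a => ?_, fun a => ?_, fun a => ?_, fun a => ?_, fun a => ?_,
    fun x s n hn => ?_⟩
  · exact ((Algebra.TensorProduct.includeLeft : A →ₐ[R] A ⊗[R] A).commutes a).trans
      ((Algebra.TensorProduct.includeRight : A →ₐ[R] A ⊗[R] A).commutes a).symm
  · change p (a ⊗ₜ 1) = a
    simp [p]
  · change p (1 ⊗ₜ a) = a
    simp [p]
  · change q (a ⊗ₜ 1) = a
    simp [q]
  · change q (1 ⊗ₜ a) = _
    simp [q, Algebra.ofId_apply]
  -- For x in I one has d₀(xa) = 0, so (x ⊗ 1)(a ⊗ b) goes to a(d₁b − b) ⊗ x, and a(d₁b − b) is q −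
  -- p at a ⊗ b. The element of J is carried along the induction as a witness, which also proves q s
  -- − p s ∈ J.
  · have key : ∀ s : A ⊗[R] A, ∃ m : J, (m : A) = q s - p s ∧ μ ((x : A) ⊗ₜ 1 * s) = m ⊗ₜ x := by
      intro s
      induction s with
      | zero => exact ⟨0, by simp, by rw [mul_zero, map_zero, TensorProduct.zero_tmul]⟩
      | add s s' hs hs' =>
        obtain ⟨m, hm, e⟩ := hs
        obtain ⟨m', hm', e'⟩ := hs'
        refine ⟨m + m', ?_, ?_⟩
        · rw [Submodule.coe_add, hm, hm', map_add, map_add]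
          ring
        · rw [mul_add, map_add, e, e', TensorProduct.add_tmul]
      | tmul a b =>
        refine ⟨a • toJ b, ?_, ?_⟩
        · change a * (algebraMap R A (d₁ b) - b) = q (a ⊗ₜ b) - p (a ⊗ₜ b)
          simp only [q, p, Algebra.TensorProduct.productMap_apply_tmul, AlgHom.id_apply,
            AlgHom.comp_apply, Algebra.ofId_apply]
          ring
        · rw [Algebra.TensorProduct.tmul_mul_tmul, one_mul]
          change toJ b ⊗ₜ toI (x * a) = _
          rw [TensorProduct.smul_tmul]
          congr 1
          refine Subtype.ext ?_
          change (x : A) * a - algebraMap R A (d₀ (x * a)) = a * x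
          rw [map_mul, (hI _).1 x.2, zero_mul, map_zero, sub_zero, mul_comm]
    obtain ⟨m, hm, e⟩ := key s
    rw [show n = m from Subtype.ext (hn.trans hm.symm)]
    exact e

end Pushout
namespace IsTwoPresented

variable {k : Type u} [CommRing k] {X : SimplicialObject (CommAlgCat.{v} k)}
  {T : Type v} {t : T → X _⦋2⦌} (P : IsTwoPresented X t)

include P

/-- On the two copies of A the composite q ∘ θ agrees with d₂, but it kills the generators t, and p
∘ θ is d₁. For z = s₁y − s₀y with y in J this gives n = y, so μ ∘ θ inverts the pairing. -/
theorem exists_tensor_retraction :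
    ∃ (S : Type v) (_ : CommRing S) (θ : X _⦋2⦌ →+* S) (q : S →+* X _⦋1⦌)
      (μ : S →+ kerFace X 1 ⊗[X _⦋1⦌] kerFace X 0),
      (∀ a, q (θ (degen X (1 : Fin 2) a)) = a) ∧
      (∀ a, q (θ (degen X (0 : Fin 2) a)) = degen X (0 : Fin 1) (face X (1 : Fin 2) a)) ∧
      (∀ τ, θ (t τ) = 0) ∧
      ∀ (x : kerFace X 0) (z : X _⦋2⦌) (n : kerFace X 1),
        (n : X _⦋1⦌) = q (θ z) - face X (1 : Fin 3) z →
          μ (θ (degen X (1 : Fin 2) (x : X _⦋1⦌) * z)) = n ⊗ₜ x := by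
  let _ : Algebra (X _⦋0⦌) (X _⦋1⦌) := (degen X (0 : Fin 1)).toRingHom.toAlgebra
  let e₀ : X _⦋1⦌ →ₐ[X _⦋0⦌] X _⦋0⦌ :=
    { (face X (0 : Fin 2)).toRingHom with commutes' := d0s0₁ X }
  let e₁ : X _⦋1⦌ →ₐ[X _⦋0⦌] X _⦋0⦌ :=
    { (face X (1 : Fin 2)).toRingHom with commutes' := d1s0₁ X }
  obtain ⟨S, _, l, r, p, q, μ, hlr, hpl, hpr, hql, hqr, hμ⟩ :=
    exists_pushout_retraction e₀ e₁ (kerFace X 1) (kerFace X 0) (fun _ => Iff.rfl)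
      (fun _ => Iff.rfl)
  obtain ⟨θ, h1, h0, ht⟩ := P.exists_hom S l r (fun _ => 0) hlr
  have hpθ : ∀ z, p (θ z) = face X (1 : Fin 3) z :=
    P.ringHom_ext_two (f := p.comp θ) (g := (face X (1 : Fin 3)).toRingHom)
      (fun a => (congrArg p (h1 a)).trans ((hpl a).trans (d1s1₂ X a).symm))
      (fun a => (congrArg p (h0 a)).trans ((hpr a).trans (d1s0₂ X a).symm))
      (fun τ => (congrArg p (ht τ)).trans ((map_zero p).trans (P.face_one τ).symm))
  refine ⟨S, _, θ, q, μ, fun a => by rw [h1, hql], fun a => by rw [h0]; exact hqr a, ht,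
    fun x z n hn => ?_⟩
  rw [map_mul, h1]
  exact hμ x (θ z) n (by rw [hn, hpθ])

variable {C : Type v} [NonUnitalCommRing C] [Module (X _⦋1⦌) C] [IsScalarTower (X _⦋1⦌) C C]
  [SMulCommClass (X _⦋1⦌) C C]

/-- This ring map refines d₂ by separating the contribution of the generators t: composing it with
(a, c) ↦ a + ∂c gives d₂ back. -/
theorem exists_unitization_hom (bdC : C →ₙₐ[X _⦋1⦌] X _⦋1⦌) (ι : T → C)
    (hι : ∀ τ, bdC (ι τ) = face X (2 : Fin 3) (t τ)) :
    ∃ Φ : X _⦋2⦌ →+* Unitization (X _⦋1⦌) C,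
      (∀ a, Φ (degen X (1 : Fin 2) a) = Unitization.inl a) ∧
      (∀ a, Φ (degen X (0 : Fin 2) a) =
        Unitization.inl (degen X (0 : Fin 1) (face X (1 : Fin 2) a))) ∧
      (∀ τ, Φ (t τ) = Unitization.inr (ι τ)) ∧
      ∀ z, face X (2 : Fin 3) z = (Φ z).fst + bdC (Φ z).snd := by
  obtain ⟨Φ, h1, h0, ht⟩ := P.exists_hom (Unitization (X _⦋1⦌) C)
    (Unitization.inlRingHom (X _⦋1⦌) C)
    ((Unitization.inlRingHom (X _⦋1⦌) C).comp
      ((degen X (0 : Fin 1)).comp (face X (1 : Fin 2))).toRingHom) (fun τ => Unitization.inr (ι τ))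
    (fun r => congrArg (Unitization.inlRingHom (X _⦋1⦌) C)
      (congrArg (degen X (0 : Fin 1)) (d1s0₁ X r)).symm)
  refine ⟨Φ, h1, h0, ht, ?_⟩
  refine P.ringHom_ext_two (f := (face X (2 : Fin 3)).toRingHom)
    (g := (Unitization.lift bdC).toRingHom.comp Φ) (fun a => ?_) (fun a => ?_) (fun τ => ?_)
  · change face X (2 : Fin 3) _ = (Φ _).fst + bdC (Φ _).snd
    rw [h1, d2s1₂]
    change a = a + bdC 0
    rw [map_zero, add_zero]
  · change face X (2 : Fin 3) _ = (Φ _).fst + bdC (Φ _).snd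
    rw [h0, d2s0₂]
    change _ = degen X (0 : Fin 1) (face X (1 : Fin 2) a) + bdC 0
    rw [map_zero, add_zero]
  · change face X (2 : Fin 3) _ = (Φ _).fst + bdC (Φ _).snd
    rw [ht]
    change _ = 0 + bdC (ι τ)
    rw [hι, zero_add]

/-- An additive map out of `E₂` which kills `∂₃(NE₃ ∩ D₃)` and is inverse to the pairing and to the
inclusion of the free crossed module on the generators. -/
theorem exists_retraction {bdC : C →ₙₐ[X _⦋1⦌] X _⦋1⦌} (hC : IsCrossedModule bdC) {ι : T → C}
    (hι : ∀ τ, bdC (ι τ) = face X (2 : Fin 3) (t τ))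
    (hJ : ∀ c, bdC c ∈ kerFace X 1) (hI : ∀ c, bdC c ∈ kerFace X 0)
    {Q : Type*} [AddCommGroup Q] (i : (kerFace X 1 ⊗[X _⦋1⦌] kerFace X 0) →+ Q) (j : C →+ Q)
    (hn : ∀ (c : C) (n : kerFace X 1), i (n ⊗ₜ ⟨bdC c, hI c⟩) = j ((n : X _⦋1⦌) • c))
    (hm : ∀ (c : C) (m : kerFace X 0), i (⟨bdC c, hJ c⟩ ⊗ₜ m) = j ((m : X _⦋1⦌) • c)) :
    ∃ ψ : X _⦋2⦌ →+ Q, (∀ z ∈ boundaryIdeal X, ψ z = 0) ∧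
      (∀ (x : kerFace X 0) (y : kerFace X 1), ψ (degen X (1 : Fin 2) (x : X _⦋1⦌) *
        (degen X (1 : Fin 2) (y : X _⦋1⦌) - degen X (0 : Fin 2) (y : X _⦋1⦌))) = i (y ⊗ₜ x)) ∧
      ∀ (a : X _⦋1⦌) τ, ψ (degen X (1 : Fin 2) a * t τ) = j (a • ι τ) := by
  obtain ⟨S, _, θ, q, μ, hq1, hq0, hθt, hμ⟩ := P.exists_tensor_retraction
  obtain ⟨Φ, hΦ1, hΦ0, hΦt, hd2⟩ := P.exists_unitization_hom bdC ι hι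
  have hqΦ : ∀ z, q (θ z) = (Φ z).fst :=
    P.ringHom_ext_two (f := q.comp θ)
      (g := (Unitization.fstHom (X _⦋1⦌) C).toRingHom.comp Φ)
      (fun a => (hq1 a).trans (congrArg (fun u : Unitization (X _⦋1⦌) C => u.fst) (hΦ1 a)).symm)
      (fun a => (hq0 a).trans (congrArg (fun u : Unitization (X _⦋1⦌) C => u.fst) (hΦ0 a)).symm)
      (fun τ => (congrArg q (hθt τ)).trans ((map_zero q).trans
        (congrArg (fun u : Unitization (X _⦋1⦌) C => u.fst) (hΦt τ)).symm))
  -- Additivity is enough, as ψ only has to provide a left inverse.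
  let ψ : X _⦋2⦌ →+ Q :=
    { toFun := fun z => i (μ (θ z)) + j (Φ z).snd
      map_zero' := by simp
      map_add' := fun z w => by
        rw [map_add, map_add, map_add, map_add, Unitization.snd_add, map_add]; abel }
  have hψ : ∀ z, ψ z = i (μ (θ z)) + j (Φ z).snd := fun _ => rfl
  -- By the crossed module law, (0, ι t)(a, c) has C-part a • ι t + ι t · c = (a + ∂c) • ι t.
  have hts : ∀ τ z, (Φ (t τ * z)).snd = (face X (2 : Fin 3) z) • ι τ := fun τ z => by
    rw [map_mul, hΦt, hd2, add_smul, hC, Unitization.snd_mul]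
    simp [mul_comm]
  have has : ∀ a z, (Φ (degen X (1 : Fin 2) a * z)).snd = a • (Φ z).snd := fun a z => by
    rw [map_mul, hΦ1, Unitization.snd_mul]
    simp
  refine ⟨ψ, P.map_boundaryIdeal_eq_zero ψ ?_ ?_ ?_, ?_, ?_⟩
  -- From d₂z = 0 the A-part of Φ z is −∂c, where c is its C-part. The relation for ∂c ⊗ m turns the
  -- tensor component into −j(x • c), which cancels the other one.
  · intro x z hx h1 h2
    have hfst : (Φ z).fst = bdC (-(Φ z).snd) := by
      rw [map_neg]
      exact eq_neg_of_add_eq_zero_left ((hd2 z).symm.trans h2)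
    rw [hψ, hμ ⟨x, hx⟩ z ⟨bdC (-(Φ z).snd), hJ _⟩ (by rw [h1, sub_zero, hqΦ, hfst]), hm, has,
      ← map_add, smul_neg, neg_add_cancel, map_zero]
  -- With Φ z = (a, c), the three terms are j(a • ι t), from the relation for n ⊗ ∂c, then j(∂(ι t)
  -- • c) = j(∂c • ι t), and −j(d₂z • ι t). They cancel because d₂z = a + ∂c.
  · intro τ z h1
    have hx : face X (0 : Fin 2) (face X (2 : Fin 3) (t τ)) = 0 := by
      rw [d0d2₂, P.face_zero, map_zero]
    have hn1 : face X (1 : Fin 2) (Φ z).fst = 0 := by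
      have h : bdC (Φ z).snd ∈ kerFace X 1 := hJ _
      have h2 := congrArg (face X (1 : Fin 2)) (hd2 z)
      rw [d1d2₂, h1, map_zero, map_add, RingHom.mem_ker.1 h, add_zero] at h2
      exact h2.symm
    have hx' : (⟨face X (2 : Fin 3) (t τ), hx⟩ : kerFace X 0) = ⟨bdC (ι τ), hI _⟩ :=
      Subtype.ext (hι τ).symm
    have hμ' := hμ ⟨face X (2 : Fin 3) (t τ), hx⟩ z ⟨(Φ z).fst, hn1⟩ (by rw [h1, sub_zero, hqΦ])
    rw [sub_mul, map_sub, hψ, hψ, hμ', hx', hn, has, hts, map_mul, hθt, zero_mul, map_zero,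
      map_zero, zero_add, ← map_add, ← map_sub, ← hι, hC, mul_comm, ← hC, ← add_smul, ← hd2,
      sub_self, map_zero]
  · intro τ z h2
    rw [hψ, hts, h2, zero_smul, map_mul, hθt, zero_mul, map_zero, map_zero, map_zero, add_zero]
  · intro x y
    have hy : face X (1 : Fin 2) (y : X _⦋1⦌) = 0 := y.2
    rw [hψ, hμ x _ y (by rw [map_sub, map_sub, map_sub, hq1, hq0, d1s1₂, d1s0₂, hy]; simp), has,
      map_sub, hΦ1, hΦ0, hy]
    simp
  · intro a τ
    rw [hψ, mul_comm, hts, d2s1₂, map_mul, hθt, zero_mul, map_zero, map_zero, zero_add]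

/-- The degree-two term of the 2-crossed complex is additively generated by the pairings and the
multiples of the classes of the generators. -/
theorem C2_mem_of_generators (H : AddSubgroup (C2 X))
    (hp : ∀ (x : kerFace X 0) (y : kerFace X 1), C2.pairing X x y ∈ H)
    (ht : ∀ (a : X _⦋1⦌) τ, a • C2.mk X (t τ)
      ((mem_moore_one X).2 ⟨P.face_zero τ, P.face_one τ⟩) ∈ H) (c : C2 X) : c ∈ H := by
  obtain ⟨z, hz, rfl⟩ := C2.mk_surjective X c
  let toQuot : C2 X →+ X _⦋2⦌ ⧸ boundaryIdeal X :=
    { toFun := fun c => c.1, map_zero' := rfl, map_add' := fun _ _ => rfl }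
  -- The preimage of H in X₂ contains the boundary ideal, as `moore_one_le` requires.
  let H' : AddSubgroup (X _⦋2⦌) :=
    (H.map toQuot).comap (Ideal.Quotient.mk (boundaryIdeal X)).toAddMonoidHom
  obtain ⟨c, hc, e⟩ := P.moore_one_le H'
    (fun w hw => ⟨0, H.zero_mem, (Ideal.Quotient.eq_zero_iff_mem.2 hw).symm⟩)
    (fun x y hx hy => ⟨_, hp ⟨x, hx⟩ ⟨y, hy⟩, rfl⟩) (fun a τ => ⟨_, ht a τ, rfl⟩) z hz
  rwa [show C2.mk X z hz = c from Subtype.ext e.symm]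

end IsTwoPresented

/-! ### Degeneracy operators in low dimensions -/

section Simplices

theorem exists_eq_σ_comp_of_le {n i : ℕ} (h : i ≤ n) (s : ⦋n + 1⦌ ⟶ ⦋i⦌) :
    ∃ (a : Fin (n + 1)) (s' : ⦋n⦌ ⟶ ⦋i⦌), s = SimplexCategory.σ a ≫ s' := by
  refine SimplexCategory.eq_σ_comp_of_not_injective s fun hs => ?_
  have := Fintype.card_le_of_injective _ hs
  simp only [SimplexCategory.len_mk, Fintype.card_fin] at this
  omega

variable {k : Type u} [CommRing k] (E : SimplicialObject (CommAlgCat.{v} k))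

theorem map_σ_comp {n i : ℕ} (a : Fin (n + 1)) (s : ⦋n⦌ ⟶ ⦋i⦌) (y : E _⦋i⦌) :
    (E.map (SimplexCategory.σ a ≫ s).op).hom y = degen E a ((E.map s.op).hom y) := by
  rw [op_comp, E.map_comp]
  rfl

theorem map_id_op {n : ℕ} (y : E _⦋n⦌) : (E.map (𝟙 ⦋n⦌ : ⦋n⦌ ⟶ ⦋n⦌).op).hom y = y := by
  rw [op_id, E.map_id]
  rfl

/-- The iterated degeneracies in dimension two of the generators are the degeneracies of those of
dimension one and the generators of dimension two. -/
theorem epi_two_cases {G : ℕ → Type v}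
    {p : (Σ m : ℕ, {s : ⦋2⦌ ⟶ ⦋m + 1⦌ // Epi s} × G m) → Prop}
    (h0 : ∀ (x : G 0) (he : Epi (SimplexCategory.σ (0 : Fin 2))),
      p ⟨0, ⟨SimplexCategory.σ (0 : Fin 2), he⟩, x⟩)
    (h1 : ∀ (x : G 0) (he : Epi (SimplexCategory.σ (1 : Fin 2))),
      p ⟨0, ⟨SimplexCategory.σ (1 : Fin 2), he⟩, x⟩)
    (h2 : ∀ (x : G 1) (he : Epi (𝟙 ⦋2⦌)), p ⟨1, ⟨𝟙 ⦋2⦌, he⟩, x⟩) (a) : p a := by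
  obtain ⟨m, ⟨s, hs⟩, x⟩ := a
  have hm := SimplexCategory.len_le_of_epi s
  change m + 1 ≤ _ at hm
  match m, s, hs, x, hm with
  | 0, s, hs, x, _ =>
    obtain ⟨i, rfl⟩ := SimplexCategory.eq_σ_of_epi s
    fin_cases i
    · exact h0 x hs
    · exact h1 x hs
  | 1, s, hs, x, _ =>
    obtain rfl := SimplexCategory.eq_id_of_epi s
    exact h2 x hs

theorem epi_one_cases {G : ℕ → Type v}
    {p : (Σ m : ℕ, {s : ⦋1⦌ ⟶ ⦋m + 1⦌ // Epi s} × G m) → Prop}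
    (h : ∀ (x : G 0) (he : Epi (𝟙 ⦋1⦌)), p ⟨0, ⟨𝟙 ⦋1⦌, he⟩, x⟩) (a) : p a := by
  obtain ⟨m, ⟨s, hs⟩, x⟩ := a
  have hm := SimplexCategory.len_le_of_epi s
  change m + 1 ≤ _ at hm
  match m, s, hs, x, hm with
  | 0, s, hs, x, _ =>
    obtain rfl := SimplexCategory.eq_id_of_epi s
    exact h x hs

theorem σ_zero_ne_σ_one : SimplexCategory.σ (0 : Fin 2) ≠ SimplexCategory.σ (1 : Fin 2) := by
  intro h
  have := congrArg (fun f => SimplexCategory.Hom.toOrderHom f (1 : Fin 3)) h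
  revert this
  decide

theorem const_one : SimplexCategory.const ⦋1⦌ ⦋0⦌ 0 = SimplexCategory.σ (0 : Fin 1) ≫ 𝟙 ⦋0⦌ :=
  Subsingleton.elim _ _

theorem const_two : SimplexCategory.const ⦋2⦌ ⦋0⦌ 0 =
    SimplexCategory.σ (0 : Fin 2) ≫ SimplexCategory.σ (0 : Fin 1) ≫ 𝟙 ⦋0⦌ :=
  Subsingleton.elim _ _

theorem map_const_one (r : E _⦋0⦌) : (E.map (SimplexCategory.const ⦋1⦌ ⦋0⦌ 0).op).hom r =
    degen E (0 : Fin 1) r := by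
  rw [const_one, map_σ_comp, map_id_op]

theorem map_const_two (r : E _⦋0⦌) : (E.map (SimplexCategory.const ⦋2⦌ ⦋0⦌ 0).op).hom r =
    degen E (0 : Fin 2) (degen E (0 : Fin 1) r) := by
  rw [const_two, map_σ_comp, map_σ_comp, map_id_op]

end Simplices

/-! ### A free simplicial algebra in dimensions one and two -/

namespace FreeData

variable {k : Type u} [CommRing k] {E : SimplicialObject (CommAlgCat.{v} k)} (F : FreeData E)

include F

theorem ringHom_ext_one {S : Type*} [CommSemiring S] {f g : E _⦋1⦌ →+* S}
    (h0 : ∀ r, f (degen E (0 : Fin 1) r) = g (degen E (0 : Fin 1) r))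
    (h : ∀ x : F.gen 0, f (F.ι x) = g (F.ι x)) (z : E _⦋1⦌) : f z = g z := by
  obtain ⟨p, rfl⟩ := (F.free 1).2 z
  refine congrFun (congrArg (fun φ : _ →+* S => (φ : _ → S)) (MvPolynomial.ringHom_ext
    (f := f.comp _) (g := g.comp _) (fun r => ?_) (fun a => ?_))) p
  · rw [RingHom.comp_apply, RingHom.comp_apply, MvPolynomial.eval₂Hom_C]
    change f ((E.map (SimplexCategory.const ⦋1⦌ ⦋0⦌ 0).op).hom r) =
      g ((E.map (SimplexCategory.const ⦋1⦌ ⦋0⦌ 0).op).hom r)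
    rw [map_const_one]
    exact h0 r
  · rw [RingHom.comp_apply, RingHom.comp_apply, MvPolynomial.eval₂Hom_X']
    revert a
    refine epi_one_cases fun x _ => ?_
    change f ((E.map (𝟙 ⦋1⦌ : ⦋1⦌ ⟶ ⦋1⦌).op).hom (F.ι x)) =
      g ((E.map (𝟙 ⦋1⦌ : ⦋1⦌ ⟶ ⦋1⦌).op).hom (F.ι x))
    rw [map_id_op]
    exact h x

theorem gen_two (H : Subring (E _⦋2⦌)) (h1 : ∀ a, degen E (1 : Fin 2) a ∈ H)
    (h0 : ∀ a, degen E (0 : Fin 2) a ∈ H) (ht : ∀ τ : F.gen 1, F.ι τ ∈ H) (z : E _⦋2⦌) :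
    z ∈ H := by
  obtain ⟨p, rfl⟩ := (F.free 2).2 z
  induction p using MvPolynomial.induction_on with
  | C r =>
    rw [MvPolynomial.eval₂Hom_C]
    change (E.map (SimplexCategory.const ⦋2⦌ ⦋0⦌ 0).op).hom r ∈ H
    rw [map_const_two]
    exact h0 _
  | add p q hp hq => rw [map_add]; exact add_mem hp hq
  | mul_X p a hp =>
    rw [map_mul, MvPolynomial.eval₂Hom_X']
    refine mul_mem hp ?_
    clear hp
    revert a
    refine epi_two_cases (fun x _ => ?_) (fun x _ => ?_) (fun x _ => ?_)
    · exact h0 (F.ι x)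
    · exact h1 (F.ι x)
    · change (E.map (𝟙 ⦋2⦌ : ⦋2⦌ ⟶ ⦋2⦌).op).hom (F.ι x) ∈ H
      rw [map_id_op]
      exact ht x

/-- E₂ is polynomial over E₀ on s₁x, s₀x and the two-dimensional generators, which are indexed by
`F.gen 1`. Values are prescribed on these variables and then compared with α and β on E₁; the
compatibility of α and β reflects s₁s₀ = s₀s₀. -/
theorem exists_hom_two (S : Type v) [CommRing S] (α β : E _⦋1⦌ →+* S) (γ : F.gen 1 → S)
    (hαβ : ∀ r, α (degen E (0 : Fin 1) r) = β (degen E (0 : Fin 1) r)) :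
    ∃ θ : E _⦋2⦌ →+* S, (∀ a, θ (degen E (1 : Fin 2) a) = α a) ∧
      (∀ a, θ (degen E (0 : Fin 2) a) = β a) ∧ ∀ τ : F.gen 1, θ (F.ι τ) = γ τ := by
  classical
  let val : (Σ m : ℕ, {s : ⦋2⦌ ⟶ ⦋m + 1⦌ // Epi s} × F.gen m) → S := fun a =>
    match a with
    | ⟨0, s, x⟩ => if s.1 = SimplexCategory.σ (1 : Fin 2) then α (F.ι x) else β (F.ι x)
    | ⟨1, _, x⟩ => γ x
    | _ => 0
  let e := RingEquiv.ofBijective _ (F.free 2)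
  let θ : E _⦋2⦌ →+* S := (MvPolynomial.eval₂Hom
    (α.comp (degen E (0 : Fin 1)).toRingHom) val).comp e.symm.toRingHom
  have hθ : ∀ p, θ (e p) = MvPolynomial.eval₂Hom (α.comp (degen E (0 : Fin 1)).toRingHom) val p :=
    fun p => congrArg (MvPolynomial.eval₂Hom (α.comp (degen E (0 : Fin 1)).toRingHom) val)
      (e.symm_apply_apply p)
  have hC : ∀ r, θ (degen E (0 : Fin 2) (degen E (0 : Fin 1) r)) =
      α (degen E (0 : Fin 1) r) := fun r => by
    rw [← map_const_two]
    have h := hθ (MvPolynomial.C r)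
    rw [MvPolynomial.eval₂Hom_C] at h
    refine Eq.trans (congrArg θ ?_) h
    exact (MvPolynomial.eval₂Hom_C (E.map (SimplexCategory.const ⦋2⦌ ⦋0⦌ 0).op).hom.toRingHom
      _ r).symm
  have hX : ∀ a, θ ((E.map a.2.1.1.op).hom (F.ι a.2.2)) = val a := fun a => by
    have h := hθ (MvPolynomial.X a)
    rw [MvPolynomial.eval₂Hom_X'] at h
    refine Eq.trans (congrArg θ ?_) h
    exact (MvPolynomial.eval₂Hom_X' (E.map (SimplexCategory.const ⦋2⦌ ⦋0⦌ 0).op).hom.toRingHom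
      (fun p : (Σ m : ℕ, {s : ⦋2⦌ ⟶ ⦋m + 1⦌ // Epi s} × F.gen m) =>
        (E.map p.2.1.1.op).hom (F.ι p.2.2)) a).symm
  refine ⟨θ, ?_, ?_, fun τ => ?_⟩
  · refine F.ringHom_ext_one (f := θ.comp (degen E (1 : Fin 2)).toRingHom) (fun r => ?_)
      (fun x => ?_)
    · change θ (degen E (1 : Fin 2) (degen E (0 : Fin 1) r)) = _
      rw [s1s0₂, hC]
    · have h := hX ⟨0, ⟨SimplexCategory.σ (1 : Fin 2), inferInstance⟩, x⟩
      exact h.trans (if_pos rfl)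
  · refine F.ringHom_ext_one (f := θ.comp (degen E (0 : Fin 2)).toRingHom) (fun r => ?_)
      (fun x => ?_)
    · exact (hC r).trans (hαβ r)
    · have h := hX ⟨0, ⟨SimplexCategory.σ (0 : Fin 2), inferInstance⟩, x⟩
      exact h.trans (if_neg σ_zero_ne_σ_one)
  · have h := hX ⟨1, ⟨𝟙 ⦋2⦌, inferInstance⟩, τ⟩
    change θ ((E.map (𝟙 ⦋2⦌ : ⦋2⦌ ⟶ ⦋2⦌).op).hom (F.ι τ)) = γ τ at h
    rwa [map_id_op] at h

end FreeData

/-! ### The 1-skeleton and the 2-skeleton are two-presented -/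

section Skeleton

variable {k : Type u} [CommRing k] (E : SimplicialObject (CommAlgCat.{v} k))

/-- For `j ≤ n` the degenerate simplices of dimension `n + 1` generate the `j`-skeleton. -/
theorem skeleton_gen {j n : ℕ} (hj : j ≤ n) (H : Subring (skeleton E j _⦋n + 1⦌))
    (h : ∀ (a : Fin (n + 1)) (y : skeleton E j _⦋n⦌), degen (skeleton E j) a y ∈ H)
    (z : skeleton E j _⦋n + 1⦌) : z ∈ H := by
  obtain ⟨z, hz⟩ := z
  suffices h : ∃ w ∈ H, w.1 = z by
    obtain ⟨w, hw, rfl⟩ := h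
    exact hw
  induction hz using Algebra.adjoin_induction with
  | mem z hz =>
    obtain ⟨i, hi, s, y, rfl⟩ := hz
    -- An operator from ⦋n + 1⦌ to ⦋i⦌ with i ≤ n is not injective, so it factors through a
    -- codegeneracy.
    obtain ⟨a, s', rfl⟩ := exists_eq_σ_comp_of_le (hi.trans hj) s
    exact ⟨_, h a ⟨(E.map s'.op).hom y, Algebra.subset_adjoin ⟨i, hi, s', y, rfl⟩⟩,
      (map_σ_comp E a s' y).symm⟩
  | algebraMap c =>
    refine ⟨_, h 0 (algebraMap k _ c), ?_⟩
    exact (degen E 0).commutes c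
  | add x y _ _ hx hy =>
    obtain ⟨x', hx', rfl⟩ := hx
    obtain ⟨y', hy', rfl⟩ := hy
    exact ⟨x' + y', add_mem hx' hy', rfl⟩
  | mul x y _ _ hx hy =>
    obtain ⟨x', hx', rfl⟩ := hx
    obtain ⟨y', hy', rfl⟩ := hy
    exact ⟨x' * y', mul_mem hx' hy', rfl⟩

variable {E}

/-- A simplex of dimension `i ≤ j`, in the `j`-skeleton, as a ring homomorphism. -/
def toSkeletonHom (E : SimplicialObject (CommAlgCat.{v} k)) {i j : ℕ} (h : i ≤ j) :
    E _⦋i⦌ →+* skeleton E j _⦋i⦌ where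
  toFun := toSkeleton E h
  map_one' := rfl
  map_mul' _ _ := rfl
  map_zero' := rfl
  map_add' _ _ := rfl

/-- For j ≥ 1 the skeleton is all of E in dimensions 0 and 1, so the map is restricted from E₂. The
membership hypothesis on ι τ lets j = 1 and j = 2 be treated together. -/
theorem skeleton_exists_hom (F : FreeData E) {j : ℕ} (hj : 1 ≤ j) (S : Type v) [CommRing S]
    (α β : skeleton E j _⦋1⦌ →+* S) (γ : F.gen 1 → S)
    (hαβ : ∀ r, α (degen (skeleton E j) (0 : Fin 1) r) = β (degen (skeleton E j) (0 : Fin 1) r)) :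
    ∃ θ : skeleton E j _⦋2⦌ →+* S, (∀ a, θ (degen (skeleton E j) (1 : Fin 2) a) = α a) ∧
      (∀ a, θ (degen (skeleton E j) (0 : Fin 2) a) = β a) ∧
      ∀ (τ : F.gen 1) (hτ : F.ι τ ∈ skeletonAlg E j (op ⦋2⦌)), θ ⟨F.ι τ, hτ⟩ = γ τ := by
  obtain ⟨θ, h1, h0, ht⟩ := F.exists_hom_two S (α.comp (toSkeletonHom E hj))
    (β.comp (toSkeletonHom E hj)) γ (fun r => hαβ (toSkeleton E (Nat.zero_le j) r))
  exact ⟨θ.comp (skeletonAlg E j (op ⦋2⦌)).val.toRingHom, fun a => h1 a.1, fun a => h0 a.1,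
    fun τ _ => ht τ⟩

theorem isTwoPresented_skeleton_one (F : FreeData E) :
    IsTwoPresented (skeleton E 1) (PEmpty.elim : PEmpty.{v + 1} → skeleton E 1 _⦋2⦌) where
  face_zero τ := τ.elim
  face_one τ := τ.elim
  gen_two H h1 h0 _ := skeleton_gen E le_rfl H fun a y => by
    fin_cases a
    · exact h0 y
    · exact h1 y
  gen_three H h := skeleton_gen E one_le_two H h
  exists_hom S _ α β _ h := by
    obtain ⟨θ, h1, h0, -⟩ := skeleton_exists_hom F le_rfl S α β 0 h
    exact ⟨θ, h1, h0, fun τ => τ.elim⟩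

theorem isTwoPresented_skeleton_two (F : FreeData E) :
    IsTwoPresented (skeleton E 2) F.gen₂ where
  face_zero τ := ((mem_moore_one _).1 (F.gen₂_mem τ)).1
  face_one τ := ((mem_moore_one _).1 (F.gen₂_mem τ)).2
  -- In dimension two the 2-skeleton is all of E₂.
  gen_two H h1 h0 ht z := F.gen_two (H.comap (toSkeletonHom E le_rfl))
    (fun a => h1 (toSkeleton E one_le_two a)) (fun a => h0 (toSkeleton E one_le_two a)) ht z.1
  gen_three H h := skeleton_gen E le_rfl H h
  exists_hom S _ α β γ h := by
    obtain ⟨θ, h1, h0, ht⟩ := skeleton_exists_hom F one_le_two S α β γ h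
    exact ⟨θ, h1, h0, fun τ => ht τ _⟩

end Skeleton

/-! ### Free crossed modules, and maps out of the coproduct and its quotient -/

section Adjoin

set_option linter.unusedSectionVars false

variable {A : Type v} [CommRing A]

theorem subset_actSpan {P : Type v} [NonUnitalCommRing P] [Module A P] {s : Set P} {x : P}
    (hx : x ∈ s) : x ∈ (actSpan A s).toSubmodule :=
  Submodule.mem_sInf.2 fun _ hN => hN.1 hx

/-- A free crossed module is spanned by its generators. -/
theorem IsFreeCrossedModule.mem_span {T : Type v} {f : T → A} {C : Type v} [NonUnitalCommRing C]
    [Module A C] [IsScalarTower A C C] [SMulCommClass A C C] {bd : C →ₙₐ[A] A} {ι : T → C}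
    (h : IsFreeCrossedModule f bd ι) (c : C) : c ∈ Submodule.span A (Set.range ι) := by
  obtain ⟨hc, hbd, huniv⟩ := h
  have hmul : ∀ c d : C, d ∈ Submodule.span A (Set.range ι) →
      c * d ∈ Submodule.span A (Set.range ι) := fun c d hd => by
    rw [← hc]
    exact Submodule.smul_mem _ _ hd
  -- The span is closed under products because c d = ∂c • d. It is thus a crossed module containing
  -- the generators, and freeness gives a map C → S whose composite with the inclusion is the
  -- identity by uniqueness.
  let S : NonUnitalSubalgebra A C :=
    { Submodule.span A (Set.range ι) with mul_mem' := fun {c d} _ hd => hmul c d hd }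
  let incl : S →ₙₐ[A] C := NonUnitalSubalgebraClass.subtype S
  obtain ⟨φ, ⟨hφ, hφι⟩, -⟩ := huniv S (bd.comp incl)
    (fun t => ⟨ι t, Submodule.subset_span ⟨t, rfl⟩⟩) (fun c d => Subtype.ext (hc c.1 d.1)) hbd
  obtain ⟨ψ, -, hψ⟩ := huniv C bd ι hc hbd
  have h1 : incl.comp φ = NonUnitalAlgHom.id A C :=
    (hψ _ ⟨hφ, fun t => congrArg Subtype.val (hφι t)⟩).trans
      (hψ _ ⟨fun _ => rfl, fun _ => rfl⟩).symm
  have h2 : ((φ c : S) : C) = c := congrArg (fun g : C →ₙₐ[A] C => g c) h1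
  rw [← h2]
  exact (φ c).2

variable {M N Q : Type v} [NonUnitalCommRing M] [Module A M] [IsScalarTower A M M]
  [SMulCommClass A M M] [NonUnitalCommRing N] [Module A N] [IsScalarTower A N N]
  [SMulCommClass A N N] [NonUnitalCommRing Q] [Module A Q]

/-- The map `M ⋊ N → Q` given by two maps into a crossed module. -/
def Semi.lift {bd₁ : M →ₙₐ[A] A} {bdQ : Q →ₙₐ[A] A} (hQ : IsCrossedModule bdQ)
    (f : M →ₙₐ[A] Q) (g : N →ₙₐ[A] Q) (hf : ∀ m, bdQ (f m) = bd₁ m) : Semi bd₁ N →ₙₐ[A] Q where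
  toFun p := f p.fst + g p.snd
  map_smul' a p := by
    simp only [Semi.fst_smul, Semi.snd_smul, map_smul, smul_add, MonoidHom.id_apply]
  map_zero' := by simp
  map_add' p q := by simp only [Semi.fst_add, Semi.snd_add, map_add]; abel
  map_mul' p q := by
    simp only [Semi.fst_mul, Semi.snd_mul, map_mul, map_add, map_smul, ← hf, mul_add, add_mul]
    -- The action terms ∂m • g n become the mixed products f m · g n by the crossed module law in Q.
    rw [hQ, hQ, mul_comm (f q.fst)]
    abel

/-- The map `M ⊔ N → Q` given by two maps into a crossed module. -/
def Coprod.lift {bd₁ : M →ₙₐ[A] A} {bd₂ : N →ₙₐ[A] A} {bdQ : Q →ₙₐ[A] A}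
    (hQ : IsCrossedModule bdQ) (f : M →ₙₐ[A] Q) (g : N →ₙₐ[A] Q) (hf : ∀ m, bdQ (f m) = bd₁ m)
    (hg : ∀ n, bdQ (g n) = bd₂ n) : Coprod bd₁ bd₂ →ₙₐ[A] Q :=
  (coprodPeiffer bd₁ bd₂).lift (Semi.lift hQ f g hf) (actSpan_le_ker _ (by
    rintro _ ⟨p, q, rfl⟩
    have h : Semi.bd bd₁ bd₂ p = bdQ (Semi.lift hQ f g hf p) := by
      change bd₁ p.fst + bd₂ p.snd = bdQ (f p.fst + g p.snd)
      rw [map_add, hf, hg]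
    rw [map_sub, map_mul, map_smul, h, hQ, sub_self]))

theorem Coprod.inl_add (bd₁ : M →ₙₐ[A] A) (bd₂ : N →ₙₐ[A] A) (m m' : M) :
    Coprod.inl bd₁ bd₂ (m + m') = Coprod.inl bd₁ bd₂ m + Coprod.inl bd₁ bd₂ m' :=
  congrArg (coprodPeiffer bd₁ bd₂).proj (Semi.ext rfl (add_zero (0 : N)).symm)

theorem Coprod.inr_add (bd₁ : M →ₙₐ[A] A) (bd₂ : N →ₙₐ[A] A) (n n' : N) :
    Coprod.inr bd₁ bd₂ (n + n') = Coprod.inr bd₁ bd₂ n + Coprod.inr bd₁ bd₂ n' :=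
  congrArg (coprodPeiffer bd₁ bd₂).proj (Semi.ext (add_zero (0 : M)).symm rfl)

theorem Coprod.exists_inl_add_inr (bd₁ : M →ₙₐ[A] A) (bd₂ : N →ₙₐ[A] A) (z : Coprod bd₁ bd₂) :
    ∃ m n, Coprod.inl bd₁ bd₂ m + Coprod.inr bd₁ bd₂ n = z := by
  obtain ⟨⟨m, n⟩, rfl⟩ := (coprodPeiffer bd₁ bd₂).proj_surj z
  exact ⟨m, n, congrArg (coprodPeiffer bd₁ bd₂).proj (Semi.ext (add_zero m) (zero_add n))⟩

variable {J I : Ideal A} {C : Type v} [NonUnitalCommRing C] [Module A C] [IsScalarTower A C C]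
  [SMulCommClass A C C] {bdC : C →ₙₐ[A] A} (hJ : ∀ c, bdC c ∈ J) (hI : ∀ c, bdC c ∈ I)

/-- The injection of the tensor product, as an additive map. -/
def Adjoin.inlHom : J ⊗[A] I →+ Adjoin J I bdC hJ hI where
  toFun := Adjoin.inl J I bdC hJ hI
  map_zero' := rfl
  map_add' s s' := congrArg (adjoinRel J I bdC hJ hI).proj (Coprod.inl_add _ _ s s')

/-- The injection of the crossed module, as an additive map. -/
def Adjoin.inrHom : C →+ Adjoin J I bdC hJ hI where
  toFun := Adjoin.inr J I bdC hJ hI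
  map_zero' := rfl
  map_add' c c' := congrArg (adjoinRel J I bdC hJ hI).proj (Coprod.inr_add _ _ c c')

theorem Adjoin.exists_inl_add_inr (z : Adjoin J I bdC hJ hI) :
    ∃ s c, Adjoin.inl J I bdC hJ hI s + Adjoin.inr J I bdC hJ hI c = z := by
  obtain ⟨w, rfl⟩ := (adjoinRel J I bdC hJ hI).proj_surj z
  obtain ⟨s, c, rfl⟩ := Coprod.exists_inl_add_inr _ _ w
  exact ⟨s, c, rfl⟩

theorem Adjoin.inl_tmul_bd (c : C) (n : J) :
    Adjoin.inl J I bdC hJ hI (n ⊗ₜ ⟨bdC c, hI c⟩) = Adjoin.inr J I bdC hJ hI ((n : A) • c) :=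
  (adjoinRel J I bdC hJ hI).proj_eq.2 (subset_actSpan (Or.inl ⟨c, n, rfl⟩))

theorem Adjoin.inl_bd_tmul (c : C) (m : I) :
    Adjoin.inl J I bdC hJ hI (⟨bdC c, hJ c⟩ ⊗ₜ m) = Adjoin.inr J I bdC hJ hI ((m : A) • c) :=
  (adjoinRel J I bdC hJ hI).proj_eq.2 (subset_actSpan (Or.inr ⟨c, m, rfl⟩))

theorem Adjoin.bd_inl (s : J ⊗[A] I) :
    Adjoin.bd J I bdC hJ hI (Adjoin.inl J I bdC hJ hI s) = idealTensorBd J I s := by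
  change idealTensorBd J I s + bdC 0 = _
  rw [map_zero, add_zero]

theorem Adjoin.bd_inr (c : C) :
    Adjoin.bd J I bdC hJ hI (Adjoin.inr J I bdC hJ hI c) = bdC c := by
  change idealTensorBd J I 0 + bdC c = _
  rw [map_zero, zero_add]

/-- The map out of `((J ⊗ I) ⊔ C) / ∼` given by two maps into a crossed module which respect the
relations. -/
def Adjoin.lift {bdQ : Q →ₙₐ[A] A} (hQ : IsCrossedModule bdQ) (f : J ⊗[A] I →ₙₐ[A] Q)
    (g : C →ₙₐ[A] Q) (hf : ∀ s, bdQ (f s) = idealTensorBd J I s) (hg : ∀ c, bdQ (g c) = bdC c)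
    (hn : ∀ (c : C) (n : J), f (n ⊗ₜ ⟨bdC c, hI c⟩) = g ((n : A) • c))
    (hm : ∀ (c : C) (m : I), f (⟨bdC c, hJ c⟩ ⊗ₜ m) = g ((m : A) • c)) :
    Adjoin J I bdC hJ hI →ₙₐ[A] Q :=
  (adjoinRel J I bdC hJ hI).lift (Coprod.lift hQ f g hf hg) (actSpan_le_ker _ (by
    have hl : ∀ s, Coprod.lift hQ f g hf hg (Coprod.inl (idealTensorBd J I) bdC s) = f s :=
      fun s => by
        change f s + g 0 = _
        rw [map_zero, add_zero]
    have hr : ∀ c, Coprod.lift hQ f g hf hg (Coprod.inr (idealTensorBd J I) bdC c) = g c :=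
      fun c => by
        change f 0 + g c = _
        rw [map_zero, zero_add]
    rintro _ (⟨c, n, rfl⟩ | ⟨c, m, rfl⟩)
    · rw [map_sub, hl, hr, hn, sub_self]
    · rw [map_sub, hl, hr, hm, sub_self]))

end Adjoin

/-! ### The relations ∼ in the degree-two term, and the two isomorphisms -/

namespace C2

variable {k : Type u} [CommRing k] (X : SimplicialObject (CommAlgCat.{v} k))

/-- The difference is (s₁d₂z − z)(s₁y − s₀y) − z · s₀y. The first product is a Peiffer element, and
the second lies in B since d₂s₀y = s₀d₁y = 0. -/
theorem pairing_bd_right (z : X _⦋2⦌) (hz : z ∈ moore X 1) (y : kerFace X 1)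
    (h : face X (2 : Fin 3) z ∈ kerFace X 0) :
    pairing X ⟨face X (2 : Fin 3) z, h⟩ y = (y : X _⦋1⦌) • mk X z hz := by
  have hy : face X (1 : Fin 2) (y : X _⦋1⦌) = 0 := y.2
  rw [pairing, smul_mk, mk_eq_mk]
  have h1 := sub_mem (peiffer_mem_boundaryIdeal X hz
    (w := degen X (1 : Fin 2) (y : X _⦋1⦌) - degen X (0 : Fin 2) (y : X _⦋1⦌))
    (by rw [map_sub, d1s1₂, d1s0₂, sub_self]))
    (moore_mul_mem_boundaryIdeal X hz (w := degen X (0 : Fin 2) (y : X _⦋1⦌))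
      (by rw [d2s0₂, hy, map_zero]))
  convert h1 using 1
  ring

/-- The elements s₁d₂z − s₀d₂z and z differ by an element of ker d₁ ∩ ker d₂. -/
theorem pairing_bd_left (z : X _⦋2⦌) (hz : z ∈ moore X 1) (x : kerFace X 0)
    (h : face X (2 : Fin 3) z ∈ kerFace X 1) :
    pairing X x ⟨face X (2 : Fin 3) z, h⟩ = (x : X _⦋1⦌) • mk X z hz := by
  have h1 := ((mem_moore_one X).1 hz).2
  rw [pairing, smul_mk, mk_eq_mk, ← mul_sub]
  refine degen_mul_mem_boundaryIdeal X x.2 ?_ ?_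
  · rw [map_sub, map_sub, d1s1₂, d1s0₂, h1]
    simp
  · rw [map_sub, map_sub, d2s1₂, d2s0₂, d1d2₂, h1]
    simp

end C2

namespace IsTwoPresented

variable {k : Type u} [CommRing k] {X : SimplicialObject (CommAlgCat.{v} k)}

/-- Without generators in dimension two, the degree-two term of the 2-crossed complex is the tensor
product `Ker d₁ ⊗ Ker d₀`. -/
theorem tensorHom_bijective {t : PEmpty.{v + 1} → X _⦋2⦌} (P : IsTwoPresented X t) :
    Function.Bijective (C2.tensorHom X) := by
  constructor
  -- With no generators the trivial crossed module serves as C, and the relations read 0 = 0.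
  · obtain ⟨ψ, hb, hp, -⟩ := P.exists_retraction (C := PUnit.{v + 1}) (bdC := 0)
      (fun _ _ => rfl) (ι := PEmpty.elim) (fun τ => τ.elim) (fun _ => zero_mem _)
      (fun _ => zero_mem _) (AddMonoidHom.id _) 0
      (fun _ n => TensorProduct.tmul_zero _ n) (fun _ m => TensorProduct.zero_tmul _ m)
    let ψ' : X _⦋2⦌ ⧸ boundaryIdeal X →+ _ :=
      QuotientAddGroup.lift (boundaryIdeal X).toAddSubgroup ψ hb
    refine Function.LeftInverse.injective (g := fun c => ψ' c.1) fun s => ?_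
    induction s with
    | zero => rw [map_zero]; exact map_zero ψ'
    | add a b ha hb =>
      rw [map_add]
      exact (map_add ψ' _ _).trans (congrArg₂ (· + ·) ha hb)
    | tmul y x => exact hp x y
  · exact P.C2_mem_of_generators (NonUnitalAlgHom.range (C2.tensorHom X)).toAddSubgroup
      (fun x y => ⟨y ⊗ₜ x, rfl⟩) (fun _ τ => τ.elim)

/-- The map exists because the target is a crossed module satisfying ∼, and it is onto because its
image contains the pairings and the multiples of the classes of the t. It is injective by the
retraction taken with values in the quotient itself, i and j being the canonical injections. -/
theorem exists_adjoin_equiv {T : Type v} {t : T → X _⦋2⦌} (P : IsTwoPresented X t)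
    (hmem : ∀ τ, t τ ∈ moore X 1) {C : Type v} [NonUnitalCommRing C] [Module (X _⦋1⦌) C]
    [IsScalarTower (X _⦋1⦌) C C] [SMulCommClass (X _⦋1⦌) C C] {bdC : C →ₙₐ[X _⦋1⦌] X _⦋1⦌}
    {ι : T → C} (hC : IsFreeCrossedModule (fun τ => face X (2 : Fin 3) (t τ)) bdC ι) :
    ∃ (hJ : ∀ c, bdC c ∈ kerFace X 1) (hI : ∀ c, bdC c ∈ kerFace X 0)
      (φ : Adjoin (kerFace X 1) (kerFace X 0) bdC hJ hI →ₙₐ[X _⦋1⦌] C2 X),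
      Function.Bijective φ ∧
      (∀ s, C2.bd X (φ s) = Adjoin.bd (kerFace X 1) (kerFace X 0) bdC hJ hI s) ∧
      (∀ (y : kerFace X 1) (x : kerFace X 0),
        φ (Adjoin.inl _ _ bdC hJ hI (y ⊗ₜ x)) = C2.pairing X x y) ∧
      ∀ τ, φ (Adjoin.inr _ _ bdC hJ hI (ι τ)) = C2.mk X (t τ) (hmem τ) := by
  -- C is spanned by its generators, so ∂C lies in any ideal containing every d₂t.
  have hbd_mem : ∀ (K : Ideal (X _⦋1⦌)), (∀ τ, face X (2 : Fin 3) (t τ) ∈ K) →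
      ∀ c, bdC c ∈ K := fun K hK c => by
    induction hC.mem_span c using Submodule.span_induction with
    | mem c hc =>
      obtain ⟨τ, rfl⟩ := hc
      rw [hC.2.1]
      exact hK τ
    | zero => rw [map_zero]; exact zero_mem _
    | add c d _ _ hc hd => rw [map_add]; exact add_mem hc hd
    | smul a c _ hc => rw [map_smul]; exact K.mul_mem_left a hc
  have hJ : ∀ c, bdC c ∈ kerFace X 1 := hbd_mem _ fun τ => by
    rw [RingHom.mem_ker, d1d2₂, P.face_one, map_zero]
  have hI : ∀ c, bdC c ∈ kerFace X 0 := hbd_mem _ fun τ => by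
    rw [RingHom.mem_ker, d0d2₂, P.face_zero, map_zero]
  obtain ⟨g, ⟨hg, hgι⟩, -⟩ := hC.2.2 (C2 X) (C2.bd X) (fun τ => C2.mk X (t τ) (hmem τ))
    (C2.isCrossedModule X) (fun _ => rfl)
  have hn : ∀ (c : C) (n : kerFace X 1),
      C2.tensorHom X (n ⊗ₜ ⟨bdC c, hI c⟩) = g ((n : X _⦋1⦌) • c) := fun c n => by
    obtain ⟨z, hz, e⟩ := C2.mk_surjective X (g c)
    have hz' : bdC c = face X (2 : Fin 3) z := by rw [← hg, ← e, C2.bd_mk]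
    rw [map_smul, ← e, ← C2.pairing_bd_right X z hz n (hz' ▸ hI c), C2.tensorHom_tmul]
    congr 1
    exact Subtype.ext hz'
  have hm : ∀ (c : C) (m : kerFace X 0),
      C2.tensorHom X (⟨bdC c, hJ c⟩ ⊗ₜ m) = g ((m : X _⦋1⦌) • c) := fun c m => by
    obtain ⟨z, hz, e⟩ := C2.mk_surjective X (g c)
    have hz' : bdC c = face X (2 : Fin 3) z := by rw [← hg, ← e, C2.bd_mk]
    rw [map_smul, ← e, ← C2.pairing_bd_left X z hz m (hz' ▸ hJ c), C2.tensorHom_tmul]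
    congr 1
    exact Subtype.ext hz'
  let φ := Adjoin.lift hJ hI (C2.isCrossedModule X) (C2.tensorHom X) g (C2.bd_tensorHom X) hg hn hm
  have hφl : ∀ s, φ (Adjoin.inl _ _ bdC hJ hI s) = C2.tensorHom X s := fun s => by
    change C2.tensorHom X s + g 0 = _
    rw [map_zero, add_zero]
  have hφr : ∀ c, φ (Adjoin.inr _ _ bdC hJ hI c) = g c := fun c => by
    change C2.tensorHom X 0 + g c = _
    rw [map_zero, zero_add]
  refine ⟨hJ, hI, φ, ⟨?_, ?_⟩, fun s => ?_, fun y x => ?_, fun τ => ?_⟩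
  · obtain ⟨ψ, hb, hp, ht⟩ := P.exists_retraction hC.1 hC.2.1 hJ hI (Adjoin.inlHom hJ hI)
      (Adjoin.inrHom hJ hI) (Adjoin.inl_tmul_bd hJ hI) (Adjoin.inl_bd_tmul hJ hI)
    let ψ' : X _⦋2⦌ ⧸ boundaryIdeal X →+ _ :=
      QuotientAddGroup.lift (boundaryIdeal X).toAddSubgroup ψ hb
    let Ψ : C2 X →+ Adjoin (kerFace X 1) (kerFace X 0) bdC hJ hI :=
      { toFun := fun c => ψ' c.1
        map_zero' := map_zero ψ'
        map_add' := fun c d => map_add ψ' c.1 d.1 }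
    have hl : ∀ s, Ψ (C2.tensorHom X s) = Adjoin.inlHom hJ hI s := fun s => by
      induction s with
      | zero => rw [map_zero, map_zero, map_zero]
      | add a b ha hb => rw [map_add, map_add, map_add, ha, hb]
      | tmul y x => exact hp x y
    -- Ψ is only additive, so the check is made on the elements a • ι τ, which span C additively.
    have hr : ∀ c, Ψ (g c) = Adjoin.inrHom hJ hI c := fun c => by
      induction hC.mem_span c using Submodule.closure_induction with
      | zero => rw [map_zero, map_zero, map_zero]
      | add c d _ _ hc hd => rw [map_add, map_add, map_add, hc, hd]
      | smul_mem a c hc =>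
        obtain ⟨τ, rfl⟩ := hc
        rw [map_smul, hgι]
        exact ht a τ
    refine Function.LeftInverse.injective (g := Ψ) fun s => ?_
    obtain ⟨s, c, rfl⟩ := Adjoin.exists_inl_add_inr hJ hI s
    rw [map_add, hφl, hφr, map_add, hl, hr]
    rfl
  · refine P.C2_mem_of_generators (NonUnitalAlgHom.range φ).toAddSubgroup (fun x y =>
      ⟨Adjoin.inl _ _ bdC hJ hI (y ⊗ₜ x), hφl _⟩) (fun a τ => ⟨Adjoin.inr _ _ bdC hJ hI (a • ι τ), ?_⟩)
    exact (hφr _).trans ((map_smul g a (ι τ)).trans (congrArg (a • ·) (hgι τ)))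
  · obtain ⟨s, c, rfl⟩ := Adjoin.exists_inl_add_inr hJ hI s
    rw [map_add, map_add, map_add, hφl, hφr, C2.bd_tensorHom, hg, Adjoin.bd_inl, Adjoin.bd_inr]
  · exact hφl _
  · exact (hφr _).trans (hgι τ)

end IsTwoPresented

end SimpAlg

theorem mainTheorem7 {k : Type u} [CommRing k] (E : SimplicialObject (CommAlgCat.{v} k))
    (F : SimpAlg.FreeData E) :
    (∃ φ : (SimpAlg.kerFace (SimpAlg.skeleton E 1) 1 ⊗[SimpAlg.skeleton E 1 _⦋1⦌]
          SimpAlg.kerFace (SimpAlg.skeleton E 1) 0) →ₙₐ[SimpAlg.skeleton E 1 _⦋1⦌]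
          SimpAlg.C2 (SimpAlg.skeleton E 1),
        Function.Bijective φ ∧
        (∀ t, SimpAlg.C2.bd (SimpAlg.skeleton E 1) (φ t) =
          SimpAlg.idealTensorBd (SimpAlg.kerFace (SimpAlg.skeleton E 1) 1)
            (SimpAlg.kerFace (SimpAlg.skeleton E 1) 0) t) ∧
        ∀ (y : SimpAlg.kerFace (SimpAlg.skeleton E 1) 1)
          (x : SimpAlg.kerFace (SimpAlg.skeleton E 1) 0),
          φ (y ⊗ₜ x) = SimpAlg.C2.pairing (SimpAlg.skeleton E 1) x y) ∧
    ∀ (C : Type v) [NonUnitalCommRing C] [Module (SimpAlg.skeleton E 2 _⦋1⦌) C]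
      [IsScalarTower (SimpAlg.skeleton E 2 _⦋1⦌) C C]
      [SMulCommClass (SimpAlg.skeleton E 2 _⦋1⦌) C C]
      (bdC : C →ₙₐ[SimpAlg.skeleton E 2 _⦋1⦌] SimpAlg.skeleton E 2 _⦋1⦌) (ι : F.gen 1 → C),
      SimpAlg.IsFreeCrossedModule
        (fun t => SimpAlg.face (SimpAlg.skeleton E 2) (Fin.last 2) (F.gen₂ t)) bdC ι →
      ∃ (hJ : ∀ c, bdC c ∈ SimpAlg.kerFace (SimpAlg.skeleton E 2) 1)
        (hI : ∀ c, bdC c ∈ SimpAlg.kerFace (SimpAlg.skeleton E 2) 0)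
        (φ : SimpAlg.Adjoin (SimpAlg.kerFace (SimpAlg.skeleton E 2) 1)
            (SimpAlg.kerFace (SimpAlg.skeleton E 2) 0) bdC hJ hI →ₙₐ[SimpAlg.skeleton E 2 _⦋1⦌]
            SimpAlg.C2 (SimpAlg.skeleton E 2)),
        Function.Bijective φ ∧
        (∀ t, SimpAlg.C2.bd (SimpAlg.skeleton E 2) (φ t) =
          SimpAlg.Adjoin.bd (SimpAlg.kerFace (SimpAlg.skeleton E 2) 1)
            (SimpAlg.kerFace (SimpAlg.skeleton E 2) 0) bdC hJ hI t) ∧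
        (∀ (y : SimpAlg.kerFace (SimpAlg.skeleton E 2) 1)
          (x : SimpAlg.kerFace (SimpAlg.skeleton E 2) 0),
          φ (SimpAlg.Adjoin.inl _ _ bdC hJ hI (y ⊗ₜ x)) =
            SimpAlg.C2.pairing (SimpAlg.skeleton E 2) x y) ∧
        ∀ t : F.gen 1, φ (SimpAlg.Adjoin.inr _ _ bdC hJ hI (ι t)) =
          SimpAlg.C2.mk (SimpAlg.skeleton E 2) (F.gen₂ t) (F.gen₂_mem t) := by
  refine ⟨⟨SimpAlg.C2.tensorHom _, (SimpAlg.isTwoPresented_skeleton_one F).tensorHom_bijective,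
    SimpAlg.C2.bd_tensorHom _, fun _ _ => rfl⟩, ?_⟩
  intro C _ _ _ _ bdC ι hC
  exact (SimpAlg.isTwoPresented_skeleton_two F).exists_adjoin_equiv F.gen₂_mem hC
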